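/- Let $\mathcal H$ be the space of translation surfaces $(X,\omega)$ of area one (a compact connected Riemann surface $X$ with a nonzero holomorphic $1$-form $\omega$, up to isomorphism) in a connected component of a stratum, i.e. of the space of translation surfaces whose singular points have prescribed orders; the singular points are the zeros of $\omega$ and, if order $0$ is among the prescribed orders, finitely many marked points. $SL(2,\mathbb R)$ acts on $\mathcal H$ by linear post-composition with the translation charts. For $\omega\in\mathcal H$ let $\Lambda_\omega\subset\mathbb C\cong\mathbb R^2$ be the set of holonomy vectors $\int_\gamma\omega$ of the saddle connections $\gamma$ of $(X,\omega)$, that is, of the oriented geodesic segments with singular endpoints and no singular point in the interior. For a bounded Borel function with compact support $f\in B_c(\mathbb R^2)$, respectively $h\in B_c(\mathbb R^4)=B_c(\mathbb R^2\times\mathbb R^2)$, put $$\widehat f(\omega)=\sum_{v\in\Lambda_\omega}f(v),\qquad \widehat h(\omega)=\sum_{v_1,v_2\in\Lambda_\omega}h(v_1,v_2).$$ Let $\kappa$ be a Haar measure on $SL(2,\mathbb R)$ (with any fixed normalization); an element of $SL(2,\mathbb R)$ is viewed as the pair $(x,y)\in\mathbb R^2\times\mathbb R^2$ of its columns, $\det(x,y)=1$.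 Let $\lambda$ be an $SL(2,\mathbb R)$-invariant Borel measure on $\mathcal H$ such that $\widehat f\in L^2(\mathcal H,\lambda)$ for every $f\in B_c(\mathbb R^2)$. Then there are measures $\nu$ on $\mathbb R\setminus\{0\}$ and $\eta$ on $\mathbb P^1(\mathbb R)=\mathbb R\cup\{\infty\}$ such that, for every $h\in B_c(\mathbb R^4)$, all the integrals below converge absolutely and $$\int_{\mathcal H}\widehat h\,d\lambda=\int_{\mathbb R\setminus\{0\}}\left(\int_{SL(2,\mathbb R)}h(tx,y)\,d\kappa(x,y)\right)d\nu(t)+\int_{\mathbb P^1(\mathbb R)}\left(\int_{\mathbb R^2}h(x,sx)\,dx\right)d\eta(s),$$ where $dx$ is Lebesgue measure and $(x,sx)$ stands for $(0,x)$ when $s=\infty$. -/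

import Mathlib

noncomputable section

open MeasureTheory Set Filter Topology

namespace SiegelVeech

/-! ## The linear action of `SL(2, ℝ)` on the plane

The plane `ℝ²` is identified with `ℂ`, the vector `(x, y)` being `x + i y`. -/

/-- The group `SL(2, ℝ)`. -/
abbrev SL2R : Type := Matrix.SpecialLinearGroup (Fin 2) ℝ

/-- The linear map of the plane `ℂ = ℝ²` with matrix `g`. -/
def linAct (g : SL2R) : ℂ →ₗ[ℝ] ℂ where
  toFun z := ⟨g 0 0 * z.re + g 0 1 * z.im, g 1 0 * z.re + g 1 1 * z.im⟩
  map_add' z w := by apply Complex.ext <;> simp <;> ring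
  map_smul' c z := by apply Complex.ext <;> simp <;> ring

theorem linAct_apply (g : SL2R) (z : ℂ) :
    linAct g z = ⟨g 0 0 * z.re + g 0 1 * z.im, g 1 0 * z.re + g 1 1 * z.im⟩ := rfl

theorem linAct_one (z : ℂ) : linAct 1 z = z := by
  apply Complex.ext <;> simp [linAct_apply]

theorem linAct_mul (g k : SL2R) (z : ℂ) : linAct (g * k) z = linAct g (linAct k z) := by
  apply Complex.ext <;>
    simp [linAct_apply, Matrix.mul_apply, Fin.sum_univ_two] <;> ring

theorem continuous_linAct (g : SL2R) : Continuous (linAct g) :=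
  (linAct g).continuous_of_finiteDimensional

/-- The linear homeomorphism of the plane with matrix `g`. -/
def planeHomeo (g : SL2R) : ℂ ≃ₜ ℂ where
  toFun := linAct g
  invFun := linAct g⁻¹
  left_inv z := by rw [← linAct_mul, inv_mul_cancel, linAct_one]
  right_inv z := by rw [← linAct_mul, mul_inv_cancel, linAct_one]
  continuous_toFun := continuous_linAct g
  continuous_invFun := continuous_linAct g⁻¹

theorem planeHomeo_apply (g : SL2R) (z : ℂ) : planeHomeo g z = linAct g z := rfl

theorem det_eq (g : SL2R) : g 0 0 * g 1 1 - g 0 1 * g 1 0 = 1 := by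
  have h := g.2
  rwa [Matrix.det_fin_two] at h

theorem linAct_det (g : SL2R) : LinearMap.det (linAct g) = 1 := by
  have h : linAct g = Matrix.toLin Complex.basisOneI Complex.basisOneI (g : Matrix _ _ ℝ) := by
    apply Complex.basisOneI.ext
    intro i
    rw [Matrix.toLin_self]
    fin_cases i <;> apply Complex.ext <;> simp [linAct_apply, Fin.sum_univ_two]
  rw [h, LinearMap.det_toLin, g.2]

/-! The next facts construct a homeomorphism `A` of the plane with `A z ^ n = g (z ^ n)`, the lift
of `g` through the branched cover `z ↦ z ^ n`. They are needed to let `SL(2, ℝ)` act on translation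
surfaces. -/

/-- The complex-linear coefficient of `g`. -/
def branchA (g : SL2R) : ℂ := ⟨(g 0 0 + g 1 1) / 2, (g 1 0 - g 0 1) / 2⟩

/-- The antilinear coefficient of `g`. -/
def branchB (g : SL2R) : ℂ := ⟨(g 0 0 - g 1 1) / 2, (g 1 0 + g 0 1) / 2⟩

theorem linAct_eq (g : SL2R) (z : ℂ) :
    linAct g z = branchA g * z + branchB g * (starRingEnd ℂ) z := by
  apply Complex.ext <;> simp [linAct_apply, branchA, branchB] <;> ring

theorem normSq_branch (g : SL2R) :
    Complex.normSq (branchA g) = Complex.normSq (branchB g) + 1 := by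
  have h := det_eq g
  simp only [Complex.normSq_apply, branchA, branchB]
  linarith [h, (by ring : (g 0 0 + g 1 1) / 2 * ((g 0 0 + g 1 1) / 2) +
    (g 1 0 - g 0 1) / 2 * ((g 1 0 - g 0 1) / 2) =
    (g 0 0 - g 1 1) / 2 * ((g 0 0 - g 1 1) / 2) + (g 1 0 + g 0 1) / 2 * ((g 1 0 + g 0 1) / 2)
     + (g 0 0 * g 1 1 - g 0 1 * g 1 0))]

theorem branchA_ne_zero (g : SL2R) : branchA g ≠ 0 := by
  intro h
  have := normSq_branch g
  rw [h, map_zero] at this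
  linarith [Complex.normSq_nonneg (branchB g)]

theorem norm_branch_lt (g : SL2R) : ‖branchB g / branchA g‖ < 1 := by
  rw [norm_div, div_lt_one (norm_pos_iff.2 (branchA_ne_zero g))]
  have := normSq_branch g
  rw [Complex.normSq_eq_norm_sq, Complex.normSq_eq_norm_sq] at this
  nlinarith [norm_nonneg (branchB g), norm_nonneg (branchA g)]

/-- The quotient `g (z ^ n) / (a z ^ n)`, where `a` is the complex-linear part of `g`. -/
def branchQ (n : ℕ) (g : SL2R) (z : ℂ) : ℂ :=
  1 + branchB g / branchA g * ((starRingEnd ℂ) z / z) ^ n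

theorem norm_conj_div_le (z : ℂ) (n : ℕ) : ‖((starRingEnd ℂ) z / z) ^ n‖ ≤ 1 := by
  rw [norm_pow, norm_div, RCLike.norm_conj]
  exact pow_le_one₀ (by positivity) (div_self_le_one _)

theorem norm_branchQ_sub (n : ℕ) (g : SL2R) (z : ℂ) :
    ‖branchB g / branchA g * ((starRingEnd ℂ) z / z) ^ n‖ < 1 := by
  rw [norm_mul]
  calc _ ≤ ‖branchB g / branchA g‖ * 1 := by gcongr; exact norm_conj_div_le z n
    _ < 1 := by rw [mul_one]; exact norm_branch_lt g

theorem branchQ_mem (n : ℕ) (g : SL2R) (z : ℂ) : branchQ n g z ∈ Complex.slitPlane := by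
  left
  have h := norm_branchQ_sub n g z
  have h2 := Complex.abs_re_le_norm (branchB g / branchA g * ((starRingEnd ℂ) z / z) ^ n)
  have h3 := (abs_lt.1 (h2.trans_lt h)).1
  rw [branchQ, Complex.add_re, Complex.one_re]
  linarith

/-- The lift of `g` through `z ↦ z ^ n`. -/
def branchMap (n : ℕ) (g : SL2R) (z : ℂ) : ℂ :=
  branchA g ^ (1 / n : ℂ) * z * branchQ n g z ^ (1 / n : ℂ)

theorem branchMap_pow (n : ℕ) (hn : n ≠ 0) (g : SL2R) (z : ℂ) :
    branchMap n g z ^ n = linAct g (z ^ n) := by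
  rw [branchMap, mul_pow, mul_pow, one_div, Complex.cpow_nat_inv_pow _ hn,
    Complex.cpow_nat_inv_pow _ hn, linAct_eq, branchQ]
  rcases eq_or_ne z 0 with rfl | hz
  · simp [hn]
  · have hA := branchA_ne_zero g
    rw [map_pow, div_pow]
    field_simp

theorem branchMap_zero (n : ℕ) (g : SL2R) : branchMap n g 0 = 0 := by
  simp [branchMap]

theorem continuous_branchMap (n : ℕ) (hn : n ≠ 0) (g : SL2R) : Continuous (branchMap n g) := by
  rw [continuous_iff_continuousAt]
  intro z
  rcases eq_or_ne z 0 with rfl | hz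
  · -- at the origin, use the continuity of the `n`-th power
    have h1 : Tendsto (fun w => branchMap n g w ^ n) (𝓝 0) (𝓝 0) := by
      simp only [branchMap_pow n hn]
      have : Continuous fun w : ℂ => linAct g (w ^ n) :=
        (continuous_linAct g).comp (continuous_pow n)
      have h := this.tendsto 0
      simpa [hn] using h
    rw [ContinuousAt, branchMap_zero, tendsto_zero_iff_norm_tendsto_zero]
    have h2 : Tendsto (fun w => ‖branchMap n g w‖ ^ n) (𝓝 0) (𝓝 0) := by
      simpa [norm_pow] using h1.norm
    have h3 := h2.rpow_const (p := (n : ℝ)⁻¹) (Or.inr (by positivity))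
    rw [Real.zero_rpow (by positivity)] at h3
    refine h3.congr fun w => ?_
    exact Real.pow_rpow_inv_natCast (norm_nonneg _) hn
  · have hq : ContinuousAt (branchQ n g) z := by
      unfold branchQ
      have : ContinuousAt (fun w : ℂ => (starRingEnd ℂ) w / w) z :=
        (Complex.continuous_conj.continuousAt).div continuousAt_id hz
      exact continuousAt_const.add (continuousAt_const.mul (this.pow n))
    unfold branchMap
    exact (continuousAt_const.mul continuousAt_id).mul
      (hq.cpow continuousAt_const (branchQ_mem n g z))

/-- A continuous self-map of the plane whose `n`-th power is `z ^ n` is a rotation. -/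
theorem exists_root (n : ℕ) (hn : n ≠ 0) (F : ℂ → ℂ) (hF : Continuous F)
    (h : ∀ z, F z ^ n = z ^ n) : ∃ c : ℂ, c ≠ 0 ∧ ∀ z, F z = c * z := by
  have hpre : IsPreconnected ({0}ᶜ : Set ℂ) :=
    (isConnected_compl_singleton_of_one_lt_rank (by simp) 0).isPreconnected
  have hcont : ContinuousOn (fun z => F z / z) ({0}ᶜ : Set ℂ) :=
    hF.continuousOn.div continuousOn_id fun z hz => hz
  have hfin : ({c : ℂ | c ^ n = 1}).Finite := by
    have : {c : ℂ | c ^ n = 1} = (Polynomial.nthRootsFinset n (1 : ℂ) : Set ℂ) := by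
      ext c
      simp [Polynomial.mem_nthRootsFinset (Nat.pos_of_ne_zero hn)]
    rw [this]
    exact Finset.finite_toSet _
  have himg : (fun z => F z / z) '' ({0}ᶜ : Set ℂ) ⊆ {c : ℂ | c ^ n = 1} := by
    rintro _ ⟨z, hz, rfl⟩
    have hz' : z ≠ 0 := hz
    change (F z / z) ^ n = 1
    rw [div_pow, h, div_self (pow_ne_zero n hz')]
  have hsub : ((fun z => F z / z) '' ({0}ᶜ : Set ℂ)).Subsingleton :=
    (hfin.subset himg).countable.isTotallyDisconnected _ subset_rfl (hpre.image _ hcont)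
  have h1 : F 1 ^ n = 1 := by simpa using h 1
  refine ⟨F 1, fun h0 => ?_, fun z => ?_⟩
  · rw [h0, zero_pow hn] at h1
    exact zero_ne_one h1
  · rcases eq_or_ne z 0 with rfl | hz
    · have := h 0
      rw [zero_pow hn] at this
      rw [mul_zero]
      exact pow_eq_zero_iff hn |>.1 this
    · have := hsub ⟨z, hz, rfl⟩ ⟨1, one_ne_zero, rfl⟩
      simp only [div_one] at this
      rw [← this, div_mul_cancel₀ _ hz]

theorem branchMap_comp (n : ℕ) (hn : n ≠ 0) (g : SL2R) :
    ∃ c : ℂ, c ≠ 0 ∧ ∀ z, branchMap n g⁻¹ (branchMap n g z) = c * z := by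
  refine exists_root n hn _ ((continuous_branchMap n hn g⁻¹).comp (continuous_branchMap n hn g))
    fun z => ?_
  rw [branchMap_pow n hn, branchMap_pow n hn, ← linAct_mul, inv_mul_cancel, linAct_one]

theorem exists_branchHomeo (n : ℕ) (hn : n ≠ 0) (g : SL2R) :
    ∃ A : ℂ ≃ₜ ℂ, A 0 = 0 ∧ ∀ z, A z ^ n = linAct g (z ^ n) := by
  obtain ⟨c, hc, h1⟩ := branchMap_comp n hn g
  obtain ⟨d, hd, h2⟩ := branchMap_comp n hn g⁻¹
  rw [inv_inv] at h2
  have hl : Function.LeftInverse (fun w => c⁻¹ * branchMap n g⁻¹ w) (branchMap n g) := by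
    intro z
    simp only [h1]
    rw [inv_mul_cancel_left₀ hc]
  have hs : Function.Surjective (branchMap n g) := fun w =>
    ⟨branchMap n g⁻¹ (d⁻¹ * w), by rw [h2, mul_inv_cancel_left₀ hd]⟩
  exact ⟨{ toFun := branchMap n g
           invFun := fun w => c⁻¹ * branchMap n g⁻¹ w
           left_inv := hl
           right_inv := hl.rightInverse_of_surjective hs
           continuous_toFun := continuous_branchMap n hn g
           continuous_invFun := continuous_const.mul (continuous_branchMap n hn g⁻¹) },
    branchMap_zero n g, branchMap_pow n hn g⟩

/-! ## Translation surfaces -/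

/-- A translation surface, that is, a compact connected Riemann surface `X` with a nonzero
holomorphic `1`-form `ω`, presented by the translation atlas of `ω`: a compact connected surface,
a finite set `sing` containing the zeros of `ω`, and away from `sing` an atlas of charts
to `ℂ` (the local primitives `∫ ω`) whose changes of charts are translations, such that at a point
of `sing` of order `k` there is a local coordinate `φ` for which `φ ^ (k + 1)` is a primitive
of `ω`. Points of `sing` of order `k ≥ 1` are the zeros of order `k`; points of order `0` are
marked points. -/
structure TranslationSurface : Type 1 where
  carrier : Type
  [top : TopologicalSpace carrier]
  [t2 : T2Space carrier]
  [compact : CompactSpace carrier]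
  [connected : ConnectedSpace carrier]
  /-- The singular points. -/
  sing : Finset carrier
  /-- The order of a singular point (its values elsewhere are irrelevant). -/
  order : carrier → ℕ
  /-- The translation charts. -/
  charts : Set (OpenPartialHomeomorph carrier ℂ)
  sing_notMem : ∀ e ∈ charts, ∀ p ∈ sing, p ∉ e.source
  cover : ∀ x, x ∉ sing → ∃ e ∈ charts, x ∈ e.source
  compat : ∀ e ∈ charts, ∀ e' ∈ charts, ∀ x ∈ e.source ∩ e'.source,
    ∃ c : ℂ, ∀ᶠ y in 𝓝 x, e' y = e y + c
  cone : ∀ p ∈ sing, ∃ φ : OpenPartialHomeomorph carrier ℂ, p ∈ φ.source ∧ φ p = 0 ∧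
    ∀ e ∈ charts, ∀ x ∈ e.source ∩ φ.source,
      ∃ c : ℂ, ∀ᶠ y in 𝓝 x, e y = φ y ^ (order p + 1) + c

attribute [instance] TranslationSurface.top TranslationSurface.t2 TranslationSurface.compact
  TranslationSurface.connected

namespace TranslationSurface

/-- The multiset of the orders of the singular points. -/
def orders (S : TranslationSurface) : Multiset ℕ := S.sing.val.map S.order

/-- `S.Near ε T`: there is a homeomorphism `S → T` matching the singular points and their
orders whose expression in translation charts differs from the identity by a map that is locally
`ε`-Lipschitz. -/
def Near (S : TranslationSurface) (ε : ℝ) (T : TranslationSurface) : Prop :=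
  ∃ h : S.carrier ≃ₜ T.carrier, (∀ x, h x ∈ T.sing ↔ x ∈ S.sing) ∧
    (∀ p ∈ S.sing, T.order (h p) = S.order p) ∧
    ∀ e ∈ S.charts, ∀ e' ∈ T.charts, ∀ x ∈ e.source, h x ∈ e'.source →
      ∃ U ∈ 𝓝 x, ∀ y ∈ U, ∀ z ∈ U, ‖(e' (h y) - e' (h z)) - (e y - e z)‖ ≤ ε * ‖e y - e z‖

/-- Isomorphism of translation surfaces: a homeomorphism that matches the singular points and
their orders and is locally a translation in the translation charts. -/
def Iso (S T : TranslationSurface) : Prop :=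
  ∃ h : S.carrier ≃ₜ T.carrier, (∀ x, h x ∈ T.sing ↔ x ∈ S.sing) ∧
    (∀ p ∈ S.sing, T.order (h p) = S.order p) ∧
    ∀ e ∈ S.charts, ∀ e' ∈ T.charts, ∀ x ∈ e.source, h x ∈ e'.source →
      ∃ c : ℂ, ∀ᶠ y in 𝓝 x, e' (h y) = e y + c

theorem Iso.refl (S : TranslationSurface) : S.Iso S :=
  ⟨Homeomorph.refl _, fun _ => Iff.rfl, fun _ _ => rfl,
    fun e he e' he' x hx hx' => S.compat e he e' he' x ⟨hx, hx'⟩⟩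

theorem Iso.symm {S T : TranslationSurface} : S.Iso T → T.Iso S := by
  rintro ⟨h, h1, h2, h3⟩
  refine ⟨h.symm, fun x => ?_, fun p hp => ?_, fun e he e' he' x hx hx' => ?_⟩
  · rw [← h1, h.apply_symm_apply]
  · rw [← h2, h.apply_symm_apply]
    rwa [← h1, h.apply_symm_apply]
  · obtain ⟨c, hc⟩ := h3 e' he' e he (h.symm x) hx' (by rwa [h.apply_symm_apply])
    refine ⟨-c, ?_⟩
    filter_upwards [(h.symm.continuous.tendsto x).eventually hc] with y hy
    rw [h.apply_symm_apply] at hy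
    rw [hy]
    ring

theorem Iso.trans {S T V : TranslationSurface} : S.Iso T → T.Iso V → S.Iso V := by
  rintro ⟨h, h1, h2, h3⟩ ⟨k, k1, k2, k3⟩
  refine ⟨h.trans k, fun x => (k1 _).trans (h1 x), fun p hp => ?_,
    fun e he e' he' x hx hx' => ?_⟩
  · exact (k2 _ ((h1 p).2 hp)).trans (h2 p hp)
  · have hxT : h x ∉ T.sing := fun hc => S.sing_notMem e he x ((h1 x).1 hc) hx
    obtain ⟨e₁, he₁, hx₁⟩ := T.cover (h x) hxT
    obtain ⟨c, hc⟩ := h3 e he e₁ he₁ x hx hx₁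
    obtain ⟨d, hd⟩ := k3 e₁ he₁ e' he' (h x) hx₁ hx'
    refine ⟨c + d, ?_⟩
    filter_upwards [hc, (h.continuous.tendsto x).eventually hd] with y hy hy'
    rw [Homeomorph.trans_apply, hy', hy]
    ring

/-- `m` is the flat area measure of `S` (the measure `|ω|²`): Lebesgue measure in the translation
charts, and without mass at the singular points. -/
def IsAreaMeasure (S : TranslationSurface) (m : @Measure S.carrier (borel S.carrier)) : Prop :=
  (∀ e ∈ S.charts, ∀ A : Set S.carrier, MeasurableSet[borel S.carrier] A → A ⊆ e.source →
    m A = volume (e '' A)) ∧ m S.sing = 0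

/-- `S` has flat area `1`. -/
def HasAreaOne (S : TranslationSurface) : Prop :=
  ∃ m : @Measure S.carrier (borel S.carrier), S.IsAreaMeasure m ∧ m univ = 1

/-- `γ : [0, 1] → S` is a saddle connection with holonomy vector `v`: a geodesic segment,
parametrized with constant speed, whose endpoints are singular and whose interior contains no
singular point. In translation charts `γ` has derivative `v`, so that `v` is the integral of `ω`
along `γ`. -/
structure IsSaddleConnection (S : TranslationSurface) (γ : ℝ → S.carrier) (v : ℂ) : Prop where
  continuousOn : ContinuousOn γ (Icc 0 1)
  left_mem : γ 0 ∈ S.sing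
  right_mem : γ 1 ∈ S.sing
  interior_notMem : ∀ t ∈ Ioo (0 : ℝ) 1, γ t ∉ S.sing
  ne_zero : v ≠ 0
  straight : ∀ t ∈ Ioo (0 : ℝ) 1, ∀ e ∈ S.charts, γ t ∈ e.source →
    ∀ᶠ s in 𝓝 t, e (γ s) = e (γ t) + ((s - t : ℝ) : ℂ) * v

/-- The set `Λ_ω` of holonomy vectors of saddle connections. -/
def holonomy (S : TranslationSurface) : Set ℂ := {v | ∃ γ, S.IsSaddleConnection γ v}

theorem Iso.holonomy_subset {S T : TranslationSurface} (hST : S.Iso T) :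
    S.holonomy ⊆ T.holonomy := by
  obtain ⟨h, h1, -, h3⟩ := hST
  rintro v ⟨γ, hγ⟩
  refine ⟨h ∘ γ, h.continuous.comp_continuousOn hγ.continuousOn, (h1 _).2 hγ.left_mem,
    (h1 _).2 hγ.right_mem, fun t ht hc => hγ.interior_notMem t ht ((h1 _).1 hc), hγ.ne_zero,
    fun t ht e' he' hx' => ?_⟩
  obtain ⟨e, he, hx⟩ := S.cover (γ t) (hγ.interior_notMem t ht)
  obtain ⟨c, hc⟩ := h3 e he e' he' (γ t) hx hx'
  have hcont : ContinuousAt γ t := hγ.continuousOn.continuousAt (Icc_mem_nhds ht.1 ht.2)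
  filter_upwards [hγ.straight t ht e he hx, hcont.eventually hc] with s hs hs'
  simp only [Function.comp_apply]
  rw [hs', hc.self_of_nhds, hs]
  ring

theorem Iso.holonomy_eq {S T : TranslationSurface} (hST : S.Iso T) : S.holonomy = T.holonomy :=
  hST.holonomy_subset.antisymm hST.symm.holonomy_subset

/-- The action of `SL(2, ℝ)`: post-composition of the translation charts with the linear map. -/
def act (g : SL2R) (S : TranslationSurface) : TranslationSurface where
  carrier := S.carrier
  sing := S.sing
  order := S.order
  charts := (fun e => e.transHomeomorph (planeHomeo g)) '' S.charts
  sing_notMem := by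
    rintro _ ⟨e, he, rfl⟩ p hp
    exact S.sing_notMem e he p hp
  cover x hx := by
    obtain ⟨e, he, hxe⟩ := S.cover x hx
    exact ⟨_, ⟨e, he, rfl⟩, hxe⟩
  compat := by
    rintro _ ⟨e, he, rfl⟩ _ ⟨e', he', rfl⟩ x hx
    obtain ⟨c, hc⟩ := S.compat e he e' he' x hx
    refine ⟨linAct g c, ?_⟩
    filter_upwards [hc] with y hy
    change linAct g (e' y) = linAct g (e y) + linAct g c
    rw [hy, map_add]
  cone p hp := by
    obtain ⟨φ, hpφ, hφ0, hφ⟩ := S.cone p hp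
    obtain ⟨A, hA0, hA⟩ := exists_branchHomeo (S.order p + 1) (Nat.succ_ne_zero _) g
    refine ⟨φ.transHomeomorph A, hpφ, ?_, ?_⟩
    · change A (φ p) = 0
      rw [hφ0, hA0]
    · rintro _ ⟨e, he, rfl⟩ x hx
      obtain ⟨c, hc⟩ := hφ e he x hx
      refine ⟨linAct g c, ?_⟩
      filter_upwards [hc] with y hy
      change linAct g (e y) = A (φ y) ^ (S.order p + 1) + linAct g c
      rw [hy, map_add, hA]

theorem orders_act (g : SL2R) (S : TranslationSurface) : (S.act g).orders = S.orders := rfl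

theorem HasAreaOne.act (g : SL2R) {S : TranslationSurface} (hS : S.HasAreaOne) :
    (S.act g).HasAreaOne := by
  obtain ⟨m, ⟨hm, hm0⟩, hm1⟩ := hS
  refine ⟨m, ⟨?_, hm0⟩, hm1⟩
  rintro _ ⟨e, he, rfl⟩ A hA hAe
  refine (hm e he A hA hAe).trans ?_
  have h : (fun x => linAct g (e x)) '' A = linAct g '' (e '' A) := (image_image _ _ _).symm
  change volume (e '' A) = volume ((fun x => linAct g (e x)) '' A)
  rw [h, Measure.addHaar_image_linearMap, linAct_det]
  simp

theorem Iso.act (g : SL2R) {S T : TranslationSurface} (hST : S.Iso T) :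
    (S.act g).Iso (T.act g) := by
  obtain ⟨h, h1, h2, h3⟩ := hST
  refine ⟨h, h1, h2, ?_⟩
  rintro _ ⟨e, he, rfl⟩ _ ⟨e', he', rfl⟩ x hx hx'
  obtain ⟨c, hc⟩ := h3 e he e' he' x hx hx'
  refine ⟨linAct g c, ?_⟩
  filter_upwards [hc] with y hy
  change linAct g (e' (h y)) = linAct g (e y) + linAct g c
  rw [hy, map_add]

theorem act_one_iso (S : TranslationSurface) : (S.act 1).Iso S := by
  refine ⟨Homeomorph.refl _, fun _ => Iff.rfl, fun _ _ => rfl, ?_⟩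
  rintro _ ⟨e, he, rfl⟩ e' he' x hx hx'
  obtain ⟨c, hc⟩ := S.compat e he e' he' x ⟨hx, hx'⟩
  refine ⟨c, ?_⟩
  filter_upwards [hc] with y hy
  change e' y = linAct 1 (e y) + c
  rw [hy, linAct_one]

theorem act_mul_iso (g k : SL2R) (S : TranslationSurface) :
    (S.act (g * k)).Iso ((S.act k).act g) := by
  refine ⟨Homeomorph.refl _, fun _ => Iff.rfl, fun _ _ => rfl, ?_⟩
  rintro _ ⟨e, he, rfl⟩ _ ⟨_, ⟨e', he', rfl⟩, rfl⟩ x hx hx'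
  obtain ⟨c, hc⟩ := S.compat e he e' he' x ⟨hx, hx'⟩
  refine ⟨linAct g (linAct k c), ?_⟩
  filter_upwards [hc] with y hy
  change linAct g (linAct k (e' y)) = linAct (g * k) (e y) + linAct g (linAct k c)
  rw [hy, map_add, map_add, linAct_mul]

theorem exists_linAct_bound (g : SL2R) : ∃ C : ℝ, 0 < C ∧ ∀ z, ‖linAct g z‖ ≤ C * ‖z‖ := by
  refine ⟨‖(linAct g).toContinuousLinearMap‖ + 1, by positivity, fun z => ?_⟩
  have := (linAct g).toContinuousLinearMap.le_opNorm z
  have h2 : ‖linAct g z‖ ≤ ‖(linAct g).toContinuousLinearMap‖ * ‖z‖ := this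
  nlinarith [norm_nonneg z]

theorem Near.act (g : SL2R) :
    ∃ C : ℝ, 0 < C ∧ ∀ (S T : TranslationSurface) (ε : ℝ), 0 ≤ ε → S.Near ε T →
      (S.act g).Near (C * ε) (T.act g) := by
  obtain ⟨C, hC, hCg⟩ := exists_linAct_bound g
  obtain ⟨D, hD, hDg⟩ := exists_linAct_bound g⁻¹
  refine ⟨C * D, by positivity, fun S T ε hε hST => ?_⟩
  obtain ⟨h, h1, h2, h3⟩ := hST
  refine ⟨h, h1, h2, ?_⟩
  rintro _ ⟨e, he, rfl⟩ _ ⟨e', he', rfl⟩ x hx hx'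
  obtain ⟨U, hU, hUε⟩ := h3 e he e' he' x hx hx'
  refine ⟨U, hU, fun y hy z hz => ?_⟩
  change ‖(linAct g (e' (h y)) - linAct g (e' (h z))) - (linAct g (e y) - linAct g (e z))‖ ≤
    C * D * ε * ‖linAct g (e y) - linAct g (e z)‖
  rw [← map_sub, ← map_sub, ← map_sub]
  have hinv : ‖e y - e z‖ ≤ D * ‖linAct g (e y - e z)‖ := by
    have := hDg (linAct g (e y - e z))
    rwa [← linAct_mul, inv_mul_cancel, linAct_one] at this
  calc _ ≤ C * ‖(e' (h y) - e' (h z)) - (e y - e z)‖ := hCg _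
    _ ≤ C * (ε * ‖e y - e z‖) := by gcongr; exact hUε y hy z hz
    _ ≤ C * (ε * (D * ‖linAct g (e y - e z)‖)) := by gcongr
    _ = _ := by ring

theorem near_act (g k : SL2R) (S : TranslationSurface) (ε : ℝ)
    (hε : ∀ z, ‖linAct k z - linAct g z‖ ≤ ε * ‖linAct g z‖) : (S.act g).Near ε (S.act k) := by
  refine ⟨Homeomorph.refl _, fun _ => Iff.rfl, fun _ _ => rfl, ?_⟩
  rintro _ ⟨e, he, rfl⟩ _ ⟨e', he', rfl⟩ x hx hx'
  obtain ⟨c, hc⟩ := S.compat e he e' he' x ⟨hx, hx'⟩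
  refine ⟨_, hc, fun y hy z hz => ?_⟩
  have hy' : e' y = e y + c := hy
  have hz' : e' z = e z + c := hz
  change ‖(linAct k (e' y) - linAct k (e' z)) - (linAct g (e y) - linAct g (e z))‖ ≤
    ε * ‖linAct g (e y) - linAct g (e z)‖
  rw [hy', hz', ← map_sub, ← map_sub, add_sub_add_right_eq_sub]
  exact hε _

end TranslationSurface

open TranslationSurface

/-! ## Strata -/

/-- The translation surfaces whose singular points have the orders prescribed by `k`. -/
def SurfaceOf (k : Multiset ℕ) : Type 1 := {S : TranslationSurface // S.orders = k}

instance surfaceSetoid (k : Multiset ℕ) : Setoid (SurfaceOf k) where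
  r S T := S.1.Iso T.1
  iseqv := ⟨fun S => Iso.refl S.1, fun h => Iso.symm h, fun h h' => Iso.trans h h'⟩

/-- The stratum of translation surfaces with singularities of the orders prescribed by `k`,
up to isomorphism. -/
def Stratum (k : Multiset ℕ) : Type 1 := Quotient (surfaceSetoid k)

/-- The isomorphism class of a translation surface. -/
def Stratum.mk {k : Multiset ℕ} (S : SurfaceOf k) : Stratum k := Quotient.mk (surfaceSetoid k) S

/-- The topology of the stratum: the sets of surfaces `ε`-near to a given surface are a basis of
its neighbourhoods. This is the topology of local period coordinates. -/
instance stratumTopology (k : Multiset ℕ) : TopologicalSpace (Stratum k) where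
  IsOpen U := ∀ S : SurfaceOf k, Stratum.mk S ∈ U →
    ∃ ε > 0, ∀ T : SurfaceOf k, S.1.Near ε T.1 → Stratum.mk T ∈ U
  isOpen_univ _ _ := ⟨1, one_pos, fun _ _ => mem_univ _⟩
  isOpen_inter U V hU hV S hS := by
    obtain ⟨ε, hε, h⟩ := hU S hS.1
    obtain ⟨δ, hδ, h'⟩ := hV S hS.2
    refine ⟨min ε δ, lt_min hε hδ, fun T ⟨f, f1, f2, f3⟩ => ⟨h T ⟨f, f1, f2, ?_⟩,
      h' T ⟨f, f1, f2, ?_⟩⟩⟩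
    all_goals
      intro e he e' he' x hx hx'
      obtain ⟨W, hW, hWε⟩ := f3 e he e' he' x hx hx'
      refine ⟨W, hW, fun y hy z hz => (hWε y hy z hz).trans ?_⟩
      gcongr
    · exact min_le_left _ _
    · exact min_le_right _ _
  isOpen_sUnion 𝒰 h𝒰 S hS := by
    obtain ⟨U, hU, hSU⟩ := hS
    obtain ⟨ε, hε, h⟩ := h𝒰 U hU S hSU
    exact ⟨ε, hε, fun T hT => ⟨U, hU, h T hT⟩⟩

theorem isOpen_stratum_iff {k : Multiset ℕ} {U : Set (Stratum k)} :
    IsOpen U ↔ ∀ S : SurfaceOf k, Stratum.mk S ∈ U →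
      ∃ ε > 0, ∀ T : SurfaceOf k, S.1.Near ε T.1 → Stratum.mk T ∈ U := Iff.rfl

/-- The action of `SL(2, ℝ)` on surfaces with prescribed orders. -/
def SurfaceOf.act {k : Multiset ℕ} (g : SL2R) (S : SurfaceOf k) : SurfaceOf k :=
  ⟨S.1.act g, S.2⟩

/-- The action of `SL(2, ℝ)` on the stratum. -/
instance stratumAction (k : Multiset ℕ) : MulAction SL2R (Stratum k) where
  smul g := Quotient.map (SurfaceOf.act g) fun _ _ h => Iso.act g h
  one_smul x := by
    induction x using Quotient.inductionOn with
    | h S => exact Quotient.sound (act_one_iso S.1)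
  mul_smul g g' x := by
    induction x using Quotient.inductionOn with
    | h S => exact Quotient.sound (act_mul_iso g g' S.1)

theorem smul_mk {k : Multiset ℕ} (g : SL2R) (S : SurfaceOf k) :
    g • Stratum.mk S = Stratum.mk (S.act g) := rfl

theorem continuous_smul_stratum {k : Multiset ℕ} (g : SL2R) :
    Continuous fun x : Stratum k => g • x := by
  refine ⟨fun U hU => ?_⟩
  rw [isOpen_stratum_iff]
  intro S hS
  obtain ⟨ε, hε, h⟩ := isOpen_stratum_iff.1 hU (S.act g) hS
  obtain ⟨C, hC, hCg⟩ := Near.act g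
  refine ⟨ε / C, by positivity, fun T hT => h (T.act g) ?_⟩
  have := hCg S.1 T.1 (ε / C) (by positivity) hT
  rwa [mul_div_cancel₀ _ hC.ne'] at this

theorem continuous_orbit {k : Multiset ℕ} (x : Stratum k) :
    Continuous fun g : SL2R => g • x := by
  induction x using Quotient.inductionOn with
  | h S =>
  refine ⟨fun U hU => ?_⟩
  rw [isOpen_iff_mem_nhds]
  intro g hg
  obtain ⟨ε, hε, h⟩ := isOpen_stratum_iff.1 hU (S.act g) hg
  have hcont : ∀ i j, Continuous fun q : SL2R => q i j := fun i j =>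
    (continuous_apply_apply i j).comp continuous_subtype_val
  obtain ⟨D, hD, hDg⟩ := exists_linAct_bound g⁻¹
  have hmat : Tendsto (fun q : SL2R => |q 0 0 - g 0 0| + |q 0 1 - g 0 1| + |q 1 0 - g 1 0| +
      |q 1 1 - g 1 1|) (𝓝 g) (𝓝 0) := by
    have : Continuous fun q : SL2R => |q 0 0 - g 0 0| + |q 0 1 - g 0 1| + |q 1 0 - g 1 0| +
        |q 1 1 - g 1 1| := by
      have h1 := hcont 0 0
      have h2 := hcont 0 1
      have h3 := hcont 1 0
      have h4 := hcont 1 1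
      fun_prop
    simpa using this.tendsto g
  filter_upwards [hmat.eventually (gt_mem_nhds (show 0 < ε / D by positivity))] with q hq
  refine h (S.act q) (near_act g q S.1 ε fun z => ?_)
  have hz : ‖z‖ ≤ D * ‖linAct g z‖ := by
    have := hDg (linAct g z)
    rwa [← linAct_mul, inv_mul_cancel, linAct_one] at this
  have hre := Complex.abs_re_le_norm z
  have him := Complex.abs_im_le_norm z
  have hdiff : ‖linAct q z - linAct g z‖ ≤ (|q 0 0 - g 0 0| + |q 0 1 - g 0 1| +
      |q 1 0 - g 1 0| + |q 1 1 - g 1 1|) * ‖z‖ := by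
    refine (Complex.norm_le_abs_re_add_abs_im _).trans ?_
    have e1 : (linAct q z - linAct g z).re =
        (q 0 0 - g 0 0) * z.re + (q 0 1 - g 0 1) * z.im := by simp [linAct_apply]; ring
    have e2 : (linAct q z - linAct g z).im =
        (q 1 0 - g 1 0) * z.re + (q 1 1 - g 1 1) * z.im := by simp [linAct_apply]; ring
    rw [e1, e2]
    have b1 := abs_add_le ((q 0 0 - g 0 0) * z.re) ((q 0 1 - g 0 1) * z.im)
    have b2 := abs_add_le ((q 1 0 - g 1 0) * z.re) ((q 1 1 - g 1 1) * z.im)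
    simp only [abs_mul] at b1 b2
    have c1 := mul_le_mul_of_nonneg_left hre (abs_nonneg (q 0 0 - g 0 0))
    have c2 := mul_le_mul_of_nonneg_left him (abs_nonneg (q 0 1 - g 0 1))
    have c3 := mul_le_mul_of_nonneg_left hre (abs_nonneg (q 1 0 - g 1 0))
    have c4 := mul_le_mul_of_nonneg_left him (abs_nonneg (q 1 1 - g 1 1))
    linarith
  calc _ ≤ _ := hdiff
    _ ≤ (ε / D) * ‖z‖ := by gcongr
    _ ≤ (ε / D) * (D * ‖linAct g z‖) := by gcongr
    _ = _ := by field_simp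

/-- Upper triangular unipotent matrices. -/
def upperU (x : ℝ) : SL2R := ⟨!![1, x; 0, 1], by simp [Matrix.det_fin_two]⟩

/-- Lower triangular unipotent matrices. -/
def lowerU (x : ℝ) : SL2R := ⟨!![1, 0; x, 1], by simp [Matrix.det_fin_two]⟩

theorem coe_upperU (x : ℝ) : (upperU x : Matrix (Fin 2) (Fin 2) ℝ) = !![1, x; 0, 1] := rfl

theorem coe_lowerU (x : ℝ) : (lowerU x : Matrix (Fin 2) (Fin 2) ℝ) = !![1, 0; x, 1] := rfl

theorem continuous_upperU : Continuous upperU := by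
  refine Continuous.subtype_mk (continuous_matrix fun i j => ?_) _
  fin_cases i <;> fin_cases j <;> simp <;> fun_prop

theorem continuous_lowerU : Continuous lowerU := by
  refine Continuous.subtype_mk (continuous_matrix fun i j => ?_) _
  fin_cases i <;> fin_cases j <;> simp <;> fun_prop

theorem exists_factor_of_ne (g : SL2R) (hg : g 1 0 ≠ 0) :
    ∃ x y z, g = upperU x * lowerU y * upperU z := by
  have hd := det_eq g
  refine ⟨(g 0 0 - 1) / g 1 0, g 1 0, (g 1 1 - 1) / g 1 0, ?_⟩
  ext i j
  fin_cases i <;> fin_cases j <;>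
    simp [coe_upperU, coe_lowerU, Matrix.mul_apply, Fin.sum_univ_two] <;> field_simp <;> linarith

theorem exists_factor (g : SL2R) :
    ∃ x y z w, g = upperU x * lowerU y * upperU z * lowerU w := by
  by_cases hg : g 1 0 = 0
  · have hd := det_eq g
    have h1 : (g * lowerU 1) 1 0 ≠ 0 := by
      simp only [Matrix.SpecialLinearGroup.coe_mul, Matrix.mul_apply, Fin.sum_univ_two, coe_lowerU]
      simp only [hg, mul_zero, sub_zero] at hd
      simp [hg]
      exact fun h0 => by simp [h0] at hd
    obtain ⟨x, y, z, h⟩ := exists_factor_of_ne _ h1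
    refine ⟨x, y, z, -1, ?_⟩
    have h2 : lowerU 1 * lowerU (-1) = 1 := by
      ext i j
      fin_cases i <;> fin_cases j <;> simp [coe_lowerU, Matrix.mul_apply, Fin.sum_univ_two]
    rw [← h, mul_assoc, h2, mul_one]
  · obtain ⟨x, y, z, h⟩ := exists_factor_of_ne _ hg
    refine ⟨x, y, z, 0, ?_⟩
    have h2 : lowerU 0 = 1 := by
      ext i j
      fin_cases i <;> fin_cases j <;> simp [coe_lowerU]
    rw [h2, mul_one, ← h]

theorem smul_mem_component {k : Multiset ℕ} (g : SL2R) (x : Stratum k) :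
    g • x ∈ connectedComponent x := by
  obtain ⟨a, b, c, d, rfl⟩ := exists_factor g
  let p : ℝ → SL2R := fun s => upperU (s * a) * lowerU (s * b) * upperU (s * c) * lowerU (s * d)
  have hp : Continuous p :=
    (((continuous_upperU.comp (continuous_mul_const a)).mul
      (continuous_lowerU.comp (continuous_mul_const b))).mul
      (continuous_upperU.comp (continuous_mul_const c))).mul
      (continuous_lowerU.comp (continuous_mul_const d))
  have hu : upperU 0 = 1 := by
    ext i j
    fin_cases i <;> fin_cases j <;> simp [coe_upperU]
  have hl : lowerU 0 = 1 := by
    ext i j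
    fin_cases i <;> fin_cases j <;> simp [coe_lowerU]
  have hrange : IsPreconnected (range fun s => p s • x) :=
    isPreconnected_range ((continuous_orbit x).comp hp)
  refine hrange.subset_connectedComponent ⟨0, ?_⟩ ⟨1, ?_⟩
  · simp [p, hu, hl]
  · simp [p]

/-- The set of holonomy vectors of saddle connections, for a point of a stratum. -/
def Stratum.holonomy {k : Multiset ℕ} : Stratum k → Set ℂ :=
  Quotient.lift (fun S : SurfaceOf k => S.1.holonomy) fun _ _ h => Iso.holonomy_eq h

/-- The set of surfaces of area `1` in the connected component of the point `c` of a stratum. -/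
def componentSet {k : Multiset ℕ} (c : Stratum k) : Set (Stratum k) :=
  {x | x ∈ connectedComponent c ∧ ∃ S : SurfaceOf k, Stratum.mk S = x ∧ S.1.HasAreaOne}

/-- The space `ℋ` of surfaces of area `1` in a connected component of a stratum. -/
abbrev AreaOne {k : Multiset ℕ} (c : Stratum k) : Type 1 := componentSet c

instance areaOneMeasurableSpace {k : Multiset ℕ} (c : Stratum k) : MeasurableSpace (AreaOne c) :=
  borel _

instance areaOneBorel {k : Multiset ℕ} (c : Stratum k) : BorelSpace (AreaOne c) := ⟨rfl⟩

theorem smul_mem_componentSet {k : Multiset ℕ} {c : Stratum k} (g : SL2R) {x : Stratum k}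
    (hx : x ∈ componentSet c) : g • x ∈ componentSet c := by
  obtain ⟨h1, S, rfl, hS⟩ := hx
  refine ⟨?_, S.act g, rfl, hS.act g⟩
  rw [connectedComponent_eq h1]
  exact smul_mem_component g _

/-- The action of `SL(2, ℝ)` on `ℋ`. -/
instance areaOneAction {k : Multiset ℕ} (c : Stratum k) : MulAction SL2R (AreaOne c) where
  smul g x := ⟨g • x.1, smul_mem_componentSet g x.2⟩
  one_smul x := Subtype.ext (one_smul _ x.1)
  mul_smul g g' x := Subtype.ext (mul_smul g g' x.1)

/-! ## Siegel-Veech transforms -/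

/-- The space `B_c` of bounded Borel functions with compact support. -/
structure IsBc {E : Type} [TopologicalSpace E] [MeasurableSpace E] (f : E → ℝ) : Prop where
  measurable : Measurable f
  bounded : ∃ C : ℝ, ∀ x, |f x| ≤ C
  compactSupport : HasCompactSupport f

/-- The Siegel-Veech transform of a function on `ℝ²`. -/
def transform {k : Multiset ℕ} {c : Stratum k} (f : ℂ → ℝ) (x : AreaOne c) : ℝ :=
  ∑' v : Stratum.holonomy x.1, f v

/-- The Siegel-Veech transform of a function on `ℝ⁴ = ℝ² × ℝ²`. -/
def transform₂ {k : Multiset ℕ} {c : Stratum k} (h : ℂ × ℂ → ℝ) (x : AreaOne c) : ℝ :=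
  ∑' v : Stratum.holonomy x.1 × Stratum.holonomy x.1, h (v.1, v.2)

/-! ## The measures on the right-hand side -/

instance sl2MeasurableSpace : MeasurableSpace SL2R := borel _

instance sl2Borel : BorelSpace SL2R := ⟨rfl⟩

instance projectiveLineMeasurableSpace : MeasurableSpace (OnePoint ℝ) := borel _

instance projectiveLineBorel : BorelSpace (OnePoint ℝ) := ⟨rfl⟩

/-- The first column of a matrix, as a vector in the plane. -/
def col₁ (g : SL2R) : ℂ := ⟨g 0 0, g 1 0⟩

/-- The second column of a matrix, as a vector in the plane. -/
def col₂ (g : SL2R) : ℂ := ⟨g 0 1, g 1 1⟩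

/-- The pair `(x, s x)` for `s` in `ℙ¹(ℝ) = ℝ ∪ {∞}`, with `(x, ∞ x) = (0, x)`. -/
def linePoint (s : OnePoint ℝ) (x : ℂ) : ℂ × ℂ :=
  match s with
  | OnePoint.infty => (0, x)
  | OnePoint.some a => (x, (a : ℂ) * x)

end SiegelVeech

end

open MeasureTheory SiegelVeech

noncomputable section

/-! The sum over pairs and the integral over `ℋ` define one measure `M = ∫ Σ δ_(v₁, v₂) dλ` on `ℝ² ×
ℝ²`, and `∫ ĥ dλ = ∫ h dM`. Three properties of `M` suffice. It is finite on bounded sets, because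
the mass of `B × B` is the integral of the square of the transform of the indicator of `B`. It is
invariant under the diagonal action of `SL(2, ℝ)`, because `Λ_(gω) = g Λ_ω`. It gives no mass to
pairs with `v₁ = 0`, because holonomy vectors are nonzero.

Pairs of nonzero determinant `t` are the `(t x, y)` with `x`, `y` the columns of a unique matrix, so
each such orbit is a copy of the group; uniqueness of Haar measure gives the part in `ν`
(`exists_eq_prod_haar`). The remaining pairs are `(x, s x)` with `x ≠ 0`, and each orbit is a
punctured plane. Its invariant measure is unique up to scale: lifting to the group, by Lebesgue
measure on the fibres of the first-column map, reduces this to Haar measure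
(`exists_eq_prod_volume`). This gives `η`, which does not charge `∞`. `exists_orbit_decomposition`
combines the two parts, and Fubini gives the formula.

Two points need care. The sums must be finite sums: this is the discreteness of `Λ_ω`
(`finite_holonomy_inter_closedBall`), proved by following a primitive of `ω` through finitely many
discs. And the pair counts must be measurable: on bounded rectangles they are products of
transforms, which are a.e. measurable by hypothesis, and a π-λ argument extends this
(`aemeasurable_pairCount`). -/

namespace SiegelVeech

open MeasureTheory Set Filter Topology
open scoped ENNReal

/-! ## Local finiteness of the set of holonomy vectors -/

namespace TranslationSurface

/-- A coordinate disc around `x`: a chart `φ` centred at `x` such that `φ ^ deg` is a local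
primitive of `ω`, and no singular point other than `x` lies in its domain. -/
structure CoordDisc (S : TranslationSurface) (x : S.carrier) where
  φ : OpenPartialHomeomorph S.carrier ℂ
  deg : ℕ
  ρ : ℝ
  deg_ne : deg ≠ 0
  ρ_pos : 0 < ρ
  mem : x ∈ φ.source
  map_zero : φ x = 0
  ball_subset : Metric.closedBall 0 ρ ⊆ φ.target
  sing : ∀ p ∈ S.sing, p ∈ φ.source → p = x
  primitive : ∀ e ∈ S.charts, ∀ y ∈ e.source ∩ φ.source,
    ∃ c : ℂ, ∀ᶠ z in 𝓝 y, e z = φ z ^ deg + c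

theorem exists_closedBall_subset_target {X : Type*} [TopologicalSpace X]
    (φ : OpenPartialHomeomorph X ℂ) {x : X} (hx : x ∈ φ.source) (h0 : φ x = 0) :
    ∃ ρ > 0, Metric.closedBall 0 ρ ⊆ φ.target := by
  have h : φ.target ∈ 𝓝 (0 : ℂ) := φ.open_target.mem_nhds (h0 ▸ φ.map_source hx)
  exact Metric.nhds_basis_closedBall.mem_iff.1 h

/-- At a singular point the cone chart is shrunk to avoid the other singular points, which form a
finite, hence closed, set. At a regular point a translation chart is recentred, with degree `1`. -/
theorem nonempty_coordDisc (S : TranslationSurface) (x : S.carrier) : Nonempty (CoordDisc S x) := by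
  by_cases hx : x ∈ S.sing
  · obtain ⟨φ, hxφ, hφ0, hφ⟩ := S.cone x hx
    have hopen : IsOpen ((↑S.sing \ {x} : Set S.carrier)ᶜ) :=
      ((S.sing.finite_toSet.subset sdiff_subset).isClosed).isOpen_compl
    let ψ := φ.restrOpen _ hopen
    have hs : ψ.source = φ.source ∩ (↑S.sing \ {x} : Set S.carrier)ᶜ := φ.restrOpen_source _ hopen
    have hxψ : x ∈ ψ.source := by
      rw [hs]
      exact ⟨hxφ, fun h => h.2 rfl⟩
    obtain ⟨ρ, hρ, hb⟩ := exists_closedBall_subset_target ψ hxψ hφ0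
    refine ⟨⟨ψ, S.order x + 1, ρ, Nat.succ_ne_zero _, hρ, hxψ, hφ0, hb, fun p hp hps => ?_,
      fun e he y hy => ?_⟩⟩
    · rw [hs] at hps
      by_contra hne
      exact hps.2 ⟨hp, hne⟩
    · rw [hs] at hy
      exact hφ e he y ⟨hy.1, hy.2.1⟩
  · obtain ⟨e, he, hxe⟩ := S.cover x hx
    let ψ := e.transHomeomorph (Homeomorph.addRight (-(e x)))
    have hψ : ∀ y, ψ y = e y + -(e x) := fun _ => rfl
    have h0 : ψ x = 0 := by rw [hψ, add_neg_cancel]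
    have hxψ : x ∈ ψ.source := hxe
    obtain ⟨ρ, hρ, hb⟩ := exists_closedBall_subset_target ψ hxψ h0
    refine ⟨⟨ψ, 1, ρ, one_ne_zero, hρ, hxψ, h0, hb, fun p hp hps => ?_, fun e' he' y hy => ?_⟩⟩
    · exact absurd hps (S.sing_notMem e he p hp)
    · obtain ⟨c, hc⟩ := S.compat e he e' he' y ⟨hy.2, hy.1⟩
      refine ⟨c + e x, ?_⟩
      filter_upwards [hc] with z hz
      rw [hz, hψ, pow_one]
      ring

namespace CoordDisc

variable {S : TranslationSurface} {x : S.carrier} (C : CoordDisc S x)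

/-- The local primitive of `ω`. -/
def prim (y : S.carrier) : ℂ := C.φ y ^ C.deg

/-- The closed disc of radius `r`. -/
def disc (r : ℝ) : Set S.carrier := {y ∈ C.φ.source | ‖C.φ y‖ ≤ r}

/-- The open disc of radius `r`. -/
def openDisc (r : ℝ) : Set S.carrier := {y ∈ C.φ.source | ‖C.φ y‖ < r}

theorem isOpen_openDisc (r : ℝ) : IsOpen (C.openDisc r) := by
  have : C.openDisc r = C.φ.source ∩ C.φ ⁻¹' Metric.ball 0 r := by
    ext y
    simp [openDisc]
  rw [this]
  exact C.φ.isOpen_inter_preimage Metric.isOpen_ball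

theorem mem_openDisc {r : ℝ} (hr : 0 < r) : x ∈ C.openDisc r :=
  ⟨C.mem, by rwa [C.map_zero, norm_zero]⟩

theorem isCompact_disc : IsCompact (C.disc C.ρ) := by
  have : C.disc C.ρ = C.φ.symm '' Metric.closedBall 0 C.ρ := by
    ext y
    constructor
    · rintro ⟨hy, hr⟩
      exact ⟨C.φ y, by simpa using hr, C.φ.left_inv hy⟩
    · rintro ⟨z, hz, rfl⟩
      refine ⟨C.φ.map_target (C.ball_subset hz), ?_⟩
      rw [C.φ.right_inv (C.ball_subset hz)]
      simpa using hz
  rw [this]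
  exact (isCompact_closedBall 0 C.ρ).image_of_continuousOn
    (C.φ.continuousOn_symm.mono C.ball_subset)

theorem continuousOn_prim : ContinuousOn C.prim C.φ.source := C.φ.continuousOn.pow _

theorem norm_prim (y : S.carrier) : ‖C.prim y‖ = ‖C.φ y‖ ^ C.deg := norm_pow _ _

/-- The variation of the primitive allowed on paths that start in the half disc. -/
def margin : ℝ := C.ρ ^ C.deg - (C.ρ / 2) ^ C.deg

theorem margin_pos : 0 < C.margin :=
  sub_pos.2 (pow_lt_pow_left₀ (half_lt_self C.ρ_pos) (half_pos C.ρ_pos).le C.deg_ne)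

/-! ### Saddle connections inside a coordinate disc. -/

theorem prim_straight {γ : ℝ → S.carrier} {v : ℂ} (hγ : S.IsSaddleConnection γ v) {t : ℝ}
    (ht : t ∈ Ioo (0 : ℝ) 1) (htC : γ t ∈ C.φ.source) :
    ∀ᶠ u in 𝓝 t, C.prim (γ u) = C.prim (γ t) + ((u - t : ℝ) : ℂ) * v := by
  obtain ⟨e, he, hte⟩ := S.cover (γ t) (hγ.interior_notMem t ht)
  obtain ⟨c, hc⟩ := C.primitive e he (γ t) ⟨hte, htC⟩
  have hcont : ContinuousAt γ t := hγ.continuousOn.continuousAt (Icc_mem_nhds ht.1 ht.2)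
  have h0 := hc.self_of_nhds
  filter_upwards [hγ.straight t ht e he hte, hcont.eventually hc] with u hu hu'
  rw [hu', h0] at hu
  unfold prim
  linear_combination hu

/-- Continuation in time: the good times form a closed set. While the affine formula holds, the
primitive has moved by less than `margin`, so the path is still in the open disc and the formula
persists a little longer. -/
theorem saddle_mem_disc_interior {γ : ℝ → S.carrier} {v : ℂ} (hγ : S.IsSaddleConnection γ v)
    {s t : ℝ} (hs : 0 < s) (hst : s ≤ t) (ht : t < 1) (hsC : γ s ∈ C.openDisc (C.ρ / 2))
    (hv : (t - s) * ‖v‖ < C.margin) :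
    γ t ∈ C.disc C.ρ ∧ C.prim (γ t) = C.prim (γ s) + ((t - s : ℝ) : ℂ) * v := by
  have hcont : ContinuousOn γ (Icc s t) := hγ.continuousOn.mono (Icc_subset_Icc hs.le ht.le)
  let A : Set ℝ := {u | γ u ∈ C.disc C.ρ ∧ C.prim (γ u) = C.prim (γ s) + ((u - s : ℝ) : ℂ) * v}
  have hclosed : IsClosed (A ∩ Icc s t) := by
    have h1 : IsClosed (Icc s t ∩ γ ⁻¹' C.disc C.ρ) :=
      hcont.preimage_isClosed_of_isClosed isClosed_Icc C.isCompact_disc.isClosed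
    have h2 : ContinuousOn (fun u => C.prim (γ u) - (C.prim (γ s) + ((u - s : ℝ) : ℂ) * v))
        (Icc s t ∩ γ ⁻¹' C.disc C.ρ) := by
      refine ContinuousOn.sub ?_ (Continuous.continuousOn (by fun_prop))
      exact C.continuousOn_prim.comp (hcont.mono inter_subset_left) fun u hu => hu.2.1
    have h3 := h2.preimage_isClosed_of_isClosed h1 (isClosed_singleton (x := (0 : ℂ)))
    convert h3 using 1
    ext u
    simp only [A, mem_inter_iff, mem_ofPred_eq, mem_preimage, mem_singleton_iff, sub_eq_zero]
    tauto
  have hsA : s ∈ A := ⟨⟨hsC.1, hsC.2.le.trans (half_le_self C.ρ_pos.le)⟩, by simp⟩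
  refine hclosed.Icc_subset_of_forall_mem_nhdsWithin hsA ?_ (right_mem_Icc.2 hst)
  rintro u ⟨⟨hu1, hu2⟩, hu3⟩
  have hu01 : u ∈ Ioo (0 : ℝ) 1 := ⟨hs.trans_le hu3.1, hu3.2.trans ht⟩
  have hlt : ‖C.prim (γ u)‖ < C.ρ ^ C.deg := by
    rw [hu2]
    have h1 : ‖C.prim (γ s)‖ ≤ (C.ρ / 2) ^ C.deg := by
      rw [norm_prim]
      exact pow_le_pow_left₀ (norm_nonneg _) hsC.2.le _
    have h2 : ‖((u - s : ℝ) : ℂ) * v‖ ≤ (t - s) * ‖v‖ := by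
      rw [norm_mul, Complex.norm_real, Real.norm_of_nonneg (sub_nonneg.2 hu3.1)]
      gcongr
      exact hu3.2.le
    have := norm_add_le (C.prim (γ s)) (((u - s : ℝ) : ℂ) * v)
    unfold margin at hv
    linarith
  have huV : γ u ∈ C.openDisc C.ρ := by
    refine ⟨hu1.1, ?_⟩
    rw [norm_prim] at hlt
    exact lt_of_pow_lt_pow_left₀ _ C.ρ_pos.le hlt
  have hcu : ContinuousAt γ u := hγ.continuousOn.continuousAt (Icc_mem_nhds hu01.1 hu01.2)
  refine mem_nhdsWithin_of_mem_nhds ?_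
  filter_upwards [hcu.eventually ((C.isOpen_openDisc _).mem_nhds huV),
    C.prim_straight hγ hu01 hu1.1] with w hw hw'
  refine ⟨⟨hw.1, hw.2.le⟩, ?_⟩
  rw [hw', hu2]
  push_cast
  ring

/-- The times `0` and `1` are now allowed. No straightness is available at these singular endpoints,
so the interior case is applied to `a < b` and passed to the limits `b → t`, then `a → s`. -/
theorem saddle_mem_disc {γ : ℝ → S.carrier} {v : ℂ} (hγ : S.IsSaddleConnection γ v)
    {s t : ℝ} (hs : 0 ≤ s) (hst : s < t) (ht : t ≤ 1) (hsC : γ s ∈ C.openDisc (C.ρ / 2))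
    (hv : (t - s) * ‖v‖ < C.margin) :
    γ t ∈ C.disc C.ρ ∧ C.prim (γ t) = C.prim (γ s) + ((t - s : ℝ) : ℂ) * v := by
  have hcs : Tendsto γ (𝓝[>] s) (𝓝 (γ s)) :=
    ((hγ.continuousOn s ⟨hs, hst.le.trans ht⟩).mono_of_mem_nhdsWithin
      (mem_nhdsWithin.2 ⟨Iio t, isOpen_Iio, hst, fun u hu =>
        ⟨hs.trans hu.2.le, hu.1.le.trans ht⟩⟩))
  have hct : Tendsto γ (𝓝[<] t) (𝓝 (γ t)) :=
    ((hγ.continuousOn t ⟨hs.trans hst.le, ht⟩).mono_of_mem_nhdsWithin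
      (mem_nhdsWithin.2 ⟨Ioi s, isOpen_Ioi, hst, fun u hu =>
        ⟨hs.trans hu.1.le, hu.2.le.trans ht⟩⟩))
  have key : ∀ᶠ a in 𝓝[>] s, ∀ᶠ b in 𝓝[<] t, γ b ∈ C.disc C.ρ ∧
      C.prim (γ b) = C.prim (γ a) + ((b - a : ℝ) : ℂ) * v := by
    filter_upwards [hcs.eventually ((C.isOpen_openDisc _).mem_nhds hsC),
      Ioo_mem_nhdsGT hst] with a ha hast
    filter_upwards [Ioo_mem_nhdsLT hast.2] with b hb
    refine C.saddle_mem_disc_interior hγ (hs.trans_lt hast.1) hb.1.le (hb.2.trans_le ht) ha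
      (lt_of_le_of_lt ?_ hv)
    gcongr
    · exact hb.2.le
    · exact hast.1.le
  have htC : γ t ∈ C.disc C.ρ := by
    obtain ⟨a, ha⟩ := key.exists
    exact C.isCompact_disc.isClosed.mem_of_tendsto hct (ha.mono fun b hb => hb.1)
  refine ⟨htC, ?_⟩
  have hpt : Tendsto (fun b => C.prim (γ b)) (𝓝[<] t) (𝓝 (C.prim (γ t))) :=
    (C.continuousOn_prim.continuousAt (C.φ.open_source.mem_nhds htC.1)).tendsto.comp hct
  have hps : Tendsto (fun a => C.prim (γ a)) (𝓝[>] s) (𝓝 (C.prim (γ s))) :=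
    (C.continuousOn_prim.continuousAt (C.φ.open_source.mem_nhds hsC.1)).tendsto.comp hcs
  have key2 : ∀ᶠ a in 𝓝[>] s, C.prim (γ t) = C.prim (γ a) + ((t - a : ℝ) : ℂ) * v := by
    filter_upwards [key] with a ha
    refine tendsto_nhds_unique_of_eventuallyEq hpt ?_ (ha.mono fun b hb => hb.2)
    have : Continuous fun b : ℝ => C.prim (γ a) + ((b - a : ℝ) : ℂ) * v := by fun_prop
    exact (this.tendsto t).mono_left nhdsWithin_le_nhds
  refine tendsto_nhds_unique_of_eventuallyEq (tendsto_const_nhds (f := 𝓝[>] s)) ?_ key2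
  have : Continuous fun a : ℝ => ((t - a : ℝ) : ℂ) * v := by fun_prop
  exact hps.add ((this.tendsto s).mono_left nhdsWithin_le_nhds)

/-- On the overlap of two discs with different centres, the primitives differ by finitely many
constants. -/
theorem finite_image_sub {y : S.carrier} (D : CoordDisc S y) (hxy : x ≠ y) :
    ((fun z => C.prim z - D.prim z) '' (C.disc C.ρ ∩ D.disc D.ρ)).Finite := by
  set K := C.disc C.ρ ∩ D.disc D.ρ
  have hK : IsCompact K := C.isCompact_disc.inter D.isCompact_disc
  -- A singular point of a disc is its centre, so the overlap has none; there both primitives differ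
  -- from a translation chart by local constants. Compactness of `K` then leaves finitely many
  -- values.
  have hloc : ∀ z ∈ K, {w | C.prim w - D.prim w = C.prim z - D.prim z} ∈ 𝓝 z := by
    intro z hz
    have hzs : z ∉ S.sing := fun h =>
      hxy ((C.sing z h hz.1.1).symm.trans (D.sing z h hz.2.1))
    obtain ⟨e, he, hze⟩ := S.cover z hzs
    obtain ⟨c, hc⟩ := C.primitive e he z ⟨hze, hz.1.1⟩
    obtain ⟨d, hd⟩ := D.primitive e he z ⟨hze, hz.2.1⟩
    have hc0 := hc.self_of_nhds
    have hd0 := hd.self_of_nhds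
    filter_upwards [hc, hd] with w hw hw'
    change C.φ w ^ C.deg - D.φ w ^ D.deg = C.φ z ^ C.deg - D.φ z ^ D.deg
    linear_combination hw' - hw + hc0 - hd0
  obtain ⟨F, hFK, hF⟩ := hK.elim_nhds_subcover _ hloc
  refine (F.finite_toSet.image fun z => C.prim z - D.prim z).subset ?_
  rintro _ ⟨w, hw, rfl⟩
  obtain ⟨z, hz, hwz⟩ := mem_iUnion₂.1 (hF hw)
  exact ⟨z, hz, hwz.symm⟩

end CoordDisc

/-- Saddle connections of bounded length have finitely many holonomy vectors. -/
theorem finite_holonomy_inter_closedBall (S : TranslationSurface) (R : ℝ) :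
    (S.holonomy ∩ Metric.closedBall 0 R).Finite := by
  let C : ∀ x, CoordDisc S x := fun x => (S.nonempty_coordDisc x).some
  obtain ⟨F, -, hF⟩ := isCompact_univ.elim_nhds_subcover (fun x => (C x).openDisc ((C x).ρ / 2))
    fun x _ => ((C x).isOpen_openDisc _).mem_nhds ((C x).mem_openDisc (half_pos (C x).ρ_pos))
  have hcover : ∀ y, ∃ x ∈ F, y ∈ (C x).openDisc ((C x).ρ / 2) := fun y => by
    simpa using hF (mem_univ y)
  -- a time step during which every saddle connection stays in one disc
  obtain ⟨δ, hδ, hδF⟩ : ∃ δ > 0, ∀ x ∈ F, δ * R < (C x).margin := by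
    have h : ∀ x ∈ F, ∀ᶠ δ in 𝓝[>] (0 : ℝ), δ * R < (C x).margin := fun x _ => by
      have h1 : Tendsto (fun δ : ℝ => δ * R) (𝓝[>] 0) (𝓝 0) :=
        ((continuous_mul_const R).tendsto' 0 0 (zero_mul R)).mono_left nhdsWithin_le_nhds
      exact h1.eventually (gt_mem_nhds (C x).margin_pos)
    obtain ⟨δ, h1, h2⟩ := (((Filter.eventually_all_finset F).2 h).and self_mem_nhdsWithin).exists
    exact ⟨δ, h2, h1⟩
  have hdiff : ({0} ∪ ⋃ x ∈ F, ⋃ y ∈ F, {d | x ≠ y ∧ d ∈ (fun z => (C x).prim z - (C y).prim z) ''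
      ((C x).disc (C x).ρ ∩ (C y).disc (C y).ρ)}).Finite := by
    refine (finite_singleton _).union (F.finite_toSet.biUnion fun x _ =>
      F.finite_toSet.biUnion fun y _ => ?_)
    by_cases hxy : x = y
    · simp [hxy]
    · exact ((C x).finite_image_sub (C y) hxy).subset fun d hd => hd.2
  set Δ : Set ℂ := {0} ∪ ⋃ x ∈ F, ⋃ y ∈ F, {d | x ≠ y ∧
    d ∈ (fun z => (C x).prim z - (C y).prim z) '' ((C x).disc (C x).ρ ∩ (C y).disc (C y).ρ)}
  have hΔ : ∀ x ∈ F, ∀ y ∈ F, ∀ z ∈ (C x).disc (C x).ρ, z ∈ (C y).disc (C y).ρ →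
      (C x).prim z - (C y).prim z ∈ Δ := by
    intro x hx y hy z hzx hzy
    by_cases hxy : x = y
    · left
      subst hxy
      simp
    · right
      exact mem_iUnion₂.2 ⟨x, hx, mem_iUnion₂.2 ⟨y, hy, hxy, z, ⟨hzx, hzy⟩, rfl⟩⟩
  -- the values at the singular points
  have hsing : (⋃ x ∈ F, (C x).prim '' S.sing).Finite :=
    F.finite_toSet.biUnion fun x _ => S.sing.finite_toSet.image _
  set Q : Set ℂ := ⋃ x ∈ F, (C x).prim '' S.sing
  have hQ : ∀ x ∈ F, ∀ p ∈ S.sing, (C x).prim p ∈ Q := fun x hx p hp =>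
    mem_iUnion₂.2 ⟨x, hx, p, hp, rfl⟩
  -- The quantity `prim (γ t) - t v` is constant while one disc is used, and changes by an element
  -- of the finite set `Δ` when the disc changes. Hence it takes finitely many values after `n` time
  -- steps, uniformly in `γ` and `v`.
  have main : ∀ n : ℕ, ∃ V : Set ℂ, V.Finite ∧ ∀ (γ : ℝ → S.carrier) (v : ℂ),
      S.IsSaddleConnection γ v → ‖v‖ ≤ R → ∀ t, 0 ≤ t → t ≤ 1 → t ≤ n * δ → ∀ x ∈ F,
      γ t ∈ (C x).disc (C x).ρ → (C x).prim (γ t) - (t : ℂ) * v ∈ V := by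
    intro n
    induction n with
    | zero =>
      refine ⟨Q, hsing, fun γ v hγ hv t ht0 ht1 htn x hx _ => ?_⟩
      obtain rfl : t = 0 := le_antisymm (by simpa using htn) ht0
      simpa using hQ x hx _ hγ.left_mem
    | succ n ih =>
      obtain ⟨V, hV, hVn⟩ := ih
      refine ⟨image2 (· + ·) Δ V, hdiff.image2 _ hV, fun γ v hγ hv t ht0 ht1 htn x hx htx => ?_⟩
      obtain ⟨s, hs0, hst, hsδ, hsn⟩ : ∃ s, 0 ≤ s ∧ s ≤ t ∧ t - s ≤ δ ∧ s ≤ n * δ := by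
        refine ⟨max (t - δ) 0, le_max_right _ _, max_le (by linarith) ht0, ?_, max_le ?_ ?_⟩
        · linarith [le_max_left (t - δ) 0]
        · push_cast at htn
          linarith
        · positivity
      obtain ⟨y, hy, hsy⟩ := hcover (γ s)
      have hstep : γ t ∈ (C y).disc (C y).ρ ∧
          (C y).prim (γ t) = (C y).prim (γ s) + ((t - s : ℝ) : ℂ) * v := by
        rcases hst.eq_or_lt with rfl | hlt
        · exact ⟨⟨hsy.1, hsy.2.le.trans (half_le_self (C y).ρ_pos.le)⟩, by simp⟩
        · refine (C y).saddle_mem_disc hγ hs0 hlt ht1 hsy (lt_of_le_of_lt ?_ (hδF y hy))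
          gcongr
      have hsV := hVn γ v hγ hv s hs0 (hst.trans ht1) hsn y hy
        ⟨hsy.1, hsy.2.le.trans (half_le_self (C y).ρ_pos.le)⟩
      refine ⟨_, hΔ x hx y hy _ htx hstep.1, _, hsV, ?_⟩
      simp only [hstep.2]
      push_cast
      ring
  -- With `n δ ≥ 1` the bound reaches `t = 1`, where `γ 1` is singular and `prim (γ 1)` lies in the
  -- finite set `Q`. So `v` is a difference of elements of two finite sets.
  obtain ⟨n, hn⟩ := exists_nat_ge (1 / δ)
  rw [div_le_iff₀ hδ] at hn
  obtain ⟨V, hV, hVn⟩ := main n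
  refine (hsing.image2 (· - ·) hV).subset ?_
  rintro v ⟨⟨γ, hγ⟩, hvR⟩
  obtain ⟨x, hx, h1x⟩ := hcover (γ 1)
  refine ⟨_, hQ x hx _ hγ.right_mem, _, hVn γ v hγ (by simpa using hvR) 1 zero_le_one le_rfl hn
    x hx ⟨h1x.1, h1x.2.le.trans (half_le_self (C x).ρ_pos.le)⟩, ?_⟩
  simp

/-! ### Equivariance of the holonomy vectors. -/

theorem smul_mem_holonomy_act (g : SL2R) {S : TranslationSurface} {v : ℂ} (hv : v ∈ S.holonomy) :
    linAct g v ∈ (S.act g).holonomy := by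
  obtain ⟨γ, hγ⟩ := hv
  refine ⟨γ, hγ.continuousOn, hγ.left_mem, hγ.right_mem, hγ.interior_notMem, fun h => ?_, ?_⟩
  · have h1 : planeHomeo g v = planeHomeo g 0 := by
      rw [planeHomeo_apply, planeHomeo_apply, h, map_zero]
    exact hγ.ne_zero ((planeHomeo g).injective h1)
  · rintro t ht _ ⟨e, he, rfl⟩ hte
    filter_upwards [hγ.straight t ht e he hte] with s hs
    change linAct g (e (γ s)) = linAct g (e (γ t)) + _
    rw [hs, map_add, ← Complex.real_smul, map_smul, Complex.real_smul]

end TranslationSurface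

theorem Stratum.zero_notMem_holonomy {k : Multiset ℕ} (x : Stratum k) : 0 ∉ x.holonomy := by
  induction x using Quotient.inductionOn with
  | h S =>
    rintro ⟨γ, hγ⟩
    exact hγ.ne_zero rfl

theorem Stratum.finite_holonomy_inter_closedBall {k : Multiset ℕ} (x : Stratum k) (R : ℝ) :
    (x.holonomy ∩ Metric.closedBall 0 R).Finite := by
  induction x using Quotient.inductionOn with
  | h S => exact S.1.finite_holonomy_inter_closedBall R

theorem Stratum.linAct_mem_holonomy {k : Multiset ℕ} (g : SL2R) {x : Stratum k} {v : ℂ}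
    (hv : v ∈ x.holonomy) : linAct g v ∈ (g • x).holonomy := by
  induction x using Quotient.inductionOn with
  | h S => exact TranslationSurface.smul_mem_holonomy_act g hv

/-- The bijection between the holonomy vectors of `x` and those of `g • x`. -/
def Stratum.holonomyEquiv {k : Multiset ℕ} (g : SL2R) (x : Stratum k) :
    x.holonomy ≃ (g • x).holonomy where
  toFun v := ⟨linAct g v, linAct_mem_holonomy g v.2⟩
  invFun v := ⟨linAct g⁻¹ v, by
    have := linAct_mem_holonomy g⁻¹ v.2
    rwa [inv_smul_smul] at this⟩
  left_inv v := Subtype.ext (by simp only; rw [← linAct_mul, inv_mul_cancel, linAct_one])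
  right_inv v := Subtype.ext (by simp only; rw [← linAct_mul, mul_inv_cancel, linAct_one])

/-! ## Invariant measures on a product with a group -/

/-- A measure on `T × G` that is invariant under left translation in the second factor is a product
with Haar measure. -/
theorem exists_eq_prod_haar {T G : Type*} [MeasurableSpace T] [Group G] [TopologicalSpace G]
    [IsTopologicalGroup G] [LocallyCompactSpace G] [SecondCountableTopology G] [MeasurableSpace G]
    [BorelSpace G] (κ : Measure G) [κ.IsHaarMeasure] (m : Measure (T × G)) (B : ℕ → Set T)
    (hB : ∀ n, MeasurableSet (B n)) (hmono : Monotone B) (hcover : ⋃ n, B n = univ)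
    (hfin : ∀ n, ∀ K : Set G, IsCompact K → m (B n ×ˢ K) < ∞)
    (hinv : ∀ (g : G) (A : Set T) (E : Set G), MeasurableSet A → MeasurableSet E →
      m (A ×ˢ ((g * ·) ⁻¹' E)) = m (A ×ˢ E)) :
    ∃ ν : Measure T, SigmaFinite ν ∧ m = ν.prod κ := by
  -- A compact set of positive finite Haar measure fixes the scale: `ν A = m (A × K) / κ K`. The
  -- closure makes it measurable, as `G` need not be Hausdorff.
  obtain ⟨K₀⟩ : Nonempty (TopologicalSpace.PositiveCompacts G) := inferInstance
  have hKm : MeasurableSet (closure (K₀ : Set G)) := isClosed_closure.measurableSet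
  set K : Set G := closure (K₀ : Set G)
  have hK : IsCompact K := K₀.isCompact.closure
  have hK0 : κ K ≠ 0 := by
    have h : 0 < κ K₀ := Measure.measure_pos_of_nonempty_interior _ K₀.interior_nonempty
    exact (h.trans_le (measure_mono subset_closure)).ne'
  have hKt : κ K ≠ ∞ := hK.measure_lt_top.ne
  let ν : Measure T := (κ K)⁻¹ • (m.restrict (univ ×ˢ K)).map Prod.fst
  have hν : ∀ A, MeasurableSet A → ν A = (κ K)⁻¹ * m (A ×ˢ K) := by
    intro A hA
    simp only [ν, Measure.smul_apply, smul_eq_mul]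
    rw [Measure.map_apply measurable_fst hA, Measure.restrict_apply (measurable_fst hA)]
    congr 2
    ext p
    simp
  -- For fixed `A` the measure `E ↦ m (A × E)` is left invariant and finite on compact sets, hence a
  -- multiple of `κ`. Taking `E = K` identifies the factor as `ν A`.
  have key : ∀ n, ∀ A ⊆ B n, MeasurableSet A → ∀ E, MeasurableSet E →
      m (A ×ˢ E) = ν A * κ E := by
    intro n A hAB hA E hE
    let μ : Measure G := (m.restrict (A ×ˢ univ)).map Prod.snd
    have hμ : ∀ E, MeasurableSet E → μ E = m (A ×ˢ E) := by
      intro E hE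
      simp only [μ]
      rw [Measure.map_apply measurable_snd hE, Measure.restrict_apply (measurable_snd hE)]
      congr 1
      ext p
      simp [and_comm]
    have : IsFiniteMeasureOnCompacts μ := ⟨fun L hL => by
      refine (measure_mono subset_closure).trans_lt ?_
      rw [hμ _ isClosed_closure.measurableSet]
      exact (measure_mono (prod_mono_left hAB)).trans_lt (hfin n _ hL.closure)⟩
    have : μ.IsMulLeftInvariant := ⟨fun g => Measure.ext fun E hE => by
      rw [Measure.map_apply (measurable_const_mul g) hE, hμ _ hE,
        hμ _ (measurable_const_mul g hE), hinv g A E hA hE]⟩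
    have h := Measure.isMulLeftInvariant_eq_smul μ κ
    have hcE : ∀ E, MeasurableSet E →
        m (A ×ˢ E) = (μ.haarScalarFactor κ : ℝ≥0∞) * κ E := by
      intro E hE
      rw [← hμ E hE]
      conv_lhs => rw [h]
      rfl
    rw [hν A hA, hcE E hE, hcE K hKm, mul_comm _ (κ K), ← mul_assoc, ENNReal.inv_mul_cancel hK0 hKt,
      one_mul]
  have hsf : SigmaFinite ν := by
    refine ⟨⟨⟨B, fun _ => trivial, fun n => ?_, hcover⟩⟩⟩
    rw [hν _ (hB n)]
    exact ENNReal.mul_lt_top (ENNReal.inv_lt_top.2 (pos_iff_ne_zero.2 hK0)) (hfin n K hK)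
  refine ⟨ν, hsf, (Measure.prod_eq fun A E hA hE => ?_).symm⟩
  -- A general `A` is the increasing union of the `A ∩ B n`, and both sides are continuous along it.
  have hmA : Monotone fun n => A ∩ B n := fun i j hij => inter_subset_inter_right _ (hmono hij)
  have hAU : A = ⋃ n, A ∩ B n := by rw [← inter_iUnion, hcover, inter_univ]
  have h1 : A ×ˢ E = ⋃ n, (A ∩ B n) ×ˢ E := by
    conv_lhs => rw [hAU]
    rw [iUnion_prod_const]
  have h2 : ν A = ⨆ n, ν (A ∩ B n) := by
    conv_lhs => rw [hAU]
    exact hmA.measure_iUnion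
  rw [h1, Monotone.measure_iUnion fun i j hij => prod_mono_left (hmA hij), h2, ENNReal.iSup_mul]
  exact iSup_congr fun n => key n _ inter_subset_right (hA.inter (hB n)) E hE

/-! ## The group `SL(2, ℝ)` -/

/-- The closed embedding into the space of matrices supplies local compactness, second countability
and entrywise measurability, as the Haar argument requires. -/
theorem isClosedEmbedding_entries :
    IsClosedEmbedding (fun (g : SL2R) (i j : Fin 2) => g i j) := by
  refine IsClosed.isClosedEmbedding_subtypeVal (X := Matrix (Fin 2) (Fin 2) ℝ) ?_
  exact isClosed_eq (continuous_id.matrix_det) continuous_const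

instance : SecondCountableTopology SL2R :=
  isClosedEmbedding_entries.isEmbedding.secondCountableTopology

instance : LocallyCompactSpace SL2R := isClosedEmbedding_entries.locallyCompactSpace

theorem continuous_entry (i j : Fin 2) : Continuous fun g : SL2R => g i j :=
  (continuous_apply_apply i j).comp continuous_subtype_val

theorem measurable_SL2R {α : Type*} [MeasurableSpace α] {f : α → SL2R}
    (hf : ∀ i j, Measurable fun a => f a i j) : Measurable f := by
  rw [isClosedEmbedding_entries.measurableEmbedding.measurable_comp_iff.symm]
  exact measurable_pi_iff.2 fun i => measurable_pi_iff.2 fun j => hf i j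

theorem continuous_col₁ : Continuous col₁ := by
  have h : col₁ = fun g : SL2R => (g 0 0 : ℂ) + (g 1 0 : ℂ) * Complex.I := by
    funext g
    apply Complex.ext <;> simp [col₁]
  rw [h]
  have h1 := continuous_entry 0 0
  have h2 := continuous_entry 1 0
  fun_prop

theorem continuous_col₂ : Continuous col₂ := by
  have h : col₂ = fun g : SL2R => (g 0 1 : ℂ) + (g 1 1 : ℂ) * Complex.I := by
    funext g
    apply Complex.ext <;> simp [col₂]
  rw [h]
  have h1 := continuous_entry 0 1
  have h2 := continuous_entry 1 1
  fun_prop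

theorem col₁_mul (g k : SL2R) : col₁ (g * k) = linAct g (col₁ k) := by
  apply Complex.ext <;> simp [col₁, linAct_apply, Matrix.mul_apply, Fin.sum_univ_two]

theorem col₂_mul (g k : SL2R) : col₂ (g * k) = linAct g (col₂ k) := by
  apply Complex.ext <;> simp [col₂, linAct_apply, Matrix.mul_apply, Fin.sum_univ_two]

theorem SL2R_ext {g k : SL2R} (h₁ : col₁ g = col₁ k) (h₂ : col₂ g = col₂ k) : g = k := by
  ext i j
  fin_cases i <;> fin_cases j
  · exact congrArg Complex.re h₁
  · exact congrArg Complex.re h₂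
  · exact congrArg Complex.im h₁
  · exact congrArg Complex.im h₂

theorem normSq_col₁_pos (g : SL2R) : 0 < g 0 0 ^ 2 + g 1 0 ^ 2 := by
  have h := det_eq g
  by_contra hle
  have h0 : g 0 0 = 0 := by nlinarith [sq_nonneg (g 0 0), sq_nonneg (g 1 0)]
  have h1 : g 1 0 = 0 := by nlinarith [sq_nonneg (g 0 0), sq_nonneg (g 1 0)]
  rw [h0, h1] at h
  norm_num at h

/-- The component of the second column along the first one. -/
def height (g : SL2R) : ℝ := (g 0 0 * g 0 1 + g 1 0 * g 1 1) / (g 0 0 ^ 2 + g 1 0 ^ 2)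

theorem continuous_height : Continuous height := by
  have h1 := continuous_entry 0 0
  have h2 := continuous_entry 1 0
  have h3 := continuous_entry 0 1
  have h4 := continuous_entry 1 1
  exact Continuous.div (by fun_prop) (by fun_prop) fun g => (normSq_col₁_pos g).ne'

theorem sq_add_sq_ne_zero {x : ℂ} (hx : x ≠ 0) : x.re ^ 2 + x.im ^ 2 ≠ 0 := by
  intro h
  apply hx
  apply Complex.ext <;> simp <;> nlinarith [sq_nonneg x.re, sq_nonneg x.im]

/-- The vector `x`, with `0` replaced by `1`. -/
def nonzeroVec (x : ℂ) : ℂ := if x = 0 then 1 else x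

theorem nonzeroVec_ne (x : ℂ) : nonzeroVec x ≠ 0 := by
  unfold nonzeroVec
  split_ifs with h
  · exact one_ne_zero
  · exact h

theorem nonzeroVec_of_ne {x : ℂ} (hx : x ≠ 0) : nonzeroVec x = x := if_neg hx

theorem measurable_nonzeroVec : Measurable nonzeroVec :=
  Measurable.ite (measurableSet_singleton 0) measurable_const measurable_id

/-- The matrix with first column `x` whose second column has component `s` along `x`. -/
def colMatrix (x : ℂ) (s : ℝ) : SL2R :=
  ⟨!![(nonzeroVec x).re, -(nonzeroVec x).im / ((nonzeroVec x).re ^ 2 + (nonzeroVec x).im ^ 2) +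
        s * (nonzeroVec x).re;
      (nonzeroVec x).im, (nonzeroVec x).re / ((nonzeroVec x).re ^ 2 + (nonzeroVec x).im ^ 2) +
        s * (nonzeroVec x).im], by
    have h := sq_add_sq_ne_zero (nonzeroVec_ne x)
    rw [Matrix.det_fin_two_of]
    field_simp
    ring⟩

theorem col₁_colMatrix (x : ℂ) (s : ℝ) : col₁ (colMatrix x s) = nonzeroVec x := rfl

theorem measurable_colMatrix : Measurable fun p : ℂ × ℝ => colMatrix p.1 p.2 := by
  have h : Measurable fun p : ℂ × ℝ => nonzeroVec p.1 := measurable_nonzeroVec.comp measurable_fst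
  have hr := Complex.measurable_re.comp h
  have hi := Complex.measurable_im.comp h
  simp only [Function.comp_def] at hr hi
  refine measurable_SL2R fun i j => ?_
  fin_cases i <;> fin_cases j
  · exact hr
  · exact (hi.neg.div ((hr.pow_const 2).add (hi.pow_const 2))).add (measurable_snd.mul hr)
  · exact hi
  · exact (hr.div ((hr.pow_const 2).add (hi.pow_const 2))).add (measurable_snd.mul hi)

theorem height_colMatrix (x : ℂ) (s : ℝ) : height (colMatrix x s) = s := by
  have h := sq_add_sq_ne_zero (nonzeroVec_ne x)
  simp only [height, colMatrix, Matrix.of_apply, Matrix.cons_val', Matrix.cons_val_zero,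
    Matrix.cons_val_one, Matrix.cons_val_fin_one]
  field_simp
  ring

/-- Matrices of determinant `1` with equal first column `x` differ by adding a multiple of `x` to
the second. Thus `(col₁, height)` are coordinates on the group, with values in nonzero vectors times
`ℝ`. -/
theorem colMatrix_height (g : SL2R) : colMatrix (col₁ g) (height g) = g := by
  have hg := normSq_col₁_pos g
  have hd := det_eq g
  have hne : col₁ g ≠ 0 := fun h => by
    have h0 : g 0 0 = 0 := congrArg Complex.re h
    have h1 : g 1 0 = 0 := congrArg Complex.im h
    rw [h0, h1] at hg
    norm_num at hg
  refine SL2R_ext (nonzeroVec_of_ne hne) ?_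
  have hv : nonzeroVec (col₁ g) = ⟨g 0 0, g 1 0⟩ := nonzeroVec_of_ne hne
  apply Complex.ext
  · change -(nonzeroVec (col₁ g)).im / ((nonzeroVec (col₁ g)).re ^ 2 + (nonzeroVec (col₁ g)).im ^ 2)
      + height g * (nonzeroVec (col₁ g)).re = g 0 1
    simp only [hv, height]
    field_simp
    linear_combination (g 1 0) * hd
  · change (nonzeroVec (col₁ g)).re / ((nonzeroVec (col₁ g)).re ^ 2 + (nonzeroVec (col₁ g)).im ^ 2)
      + height g * (nonzeroVec (col₁ g)).im = g 1 1
    simp only [hv, height]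
    field_simp
    linear_combination (-g 0 0) * hd

/-- The second column is `y₀ + s x`, so its image under `g` is `g y₀ + s g x`. Left multiplication
therefore translates the fibre coordinate `s` and preserves Lebesgue measure on the fibres. -/
theorem height_mul_colMatrix (g : SL2R) (x : ℂ) (s : ℝ) :
    height (g * colMatrix x s) = s + height (g * colMatrix x 0) := by
  have h0 := normSq_col₁_pos (g * colMatrix x 0)
  have hmul : ∀ (k : SL2R) (i j : Fin 2), (g * k) i j = g i 0 * k 0 j + g i 1 * k 1 j :=
    fun k i j => by simp [Matrix.mul_apply, Fin.sum_univ_two]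
  have e01 : colMatrix x s 0 1 = colMatrix x 0 0 1 + s * colMatrix x 0 0 0 := by simp [colMatrix]
  have e11 : colMatrix x s 1 1 = colMatrix x 0 1 1 + s * colMatrix x 0 1 0 := by simp [colMatrix]
  have h00 : (g * colMatrix x s) 0 0 = (g * colMatrix x 0) 0 0 := by rw [hmul, hmul]; rfl
  have h10 : (g * colMatrix x s) 1 0 = (g * colMatrix x 0) 1 0 := by rw [hmul, hmul]; rfl
  have h01 : (g * colMatrix x s) 0 1 = (g * colMatrix x 0) 0 1 + s * (g * colMatrix x 0) 0 0 := by
    rw [hmul, hmul, hmul, e01, e11]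
    ring
  have h11 : (g * colMatrix x s) 1 1 = (g * colMatrix x 0) 1 1 + s * (g * colMatrix x 0) 1 0 := by
    rw [hmul, hmul, hmul, e01, e11]
    ring
  unfold height
  rw [h00, h10, h01, h11]
  field_simp
  ring

theorem mul_colMatrix (g : SL2R) {x : ℂ} (hx : x ≠ 0) (s : ℝ) :
    g * colMatrix x s = colMatrix (linAct g x) (s + height (g * colMatrix x 0)) := by
  rw [← height_mul_colMatrix]
  conv_lhs => rw [← colMatrix_height (g * colMatrix x s), col₁_mul, col₁_colMatrix,
    nonzeroVec_of_ne hx]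

theorem measurable_linAct (g : SL2R) : Measurable (linAct g) := (continuous_linAct g).measurable

theorem map_linAct_volume (g : SL2R) : (volume : Measure ℂ).map (linAct g) = volume := by
  have h : LinearMap.det (linAct g) ≠ 0 := by rw [linAct_det]; exact one_ne_zero
  rw [Measure.map_linearMap_addHaar_eq_smul_addHaar _ h, linAct_det]
  simp

/-! ## Invariant measures on a product with the plane -/

section PlaneProduct

variable {T : Type*} [MeasurableSpace T]

theorem ae_snd_ne_zero {μ : Measure (T × ℂ)} (h0 : μ (univ ×ˢ {0}) = 0) : ∀ᵐ p ∂μ, p.2 ≠ 0 := by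
  rw [ae_iff]
  convert h0 using 2
  ext p
  simp

/-- Left translation by `g` acts on the coordinates `(x, s)` as a skew product: `linAct g` on `x`,
which preserves `μ`, and a translation in `s`, which preserves Lebesgue measure. The value of
`colMatrix` at `x = 0` is immaterial by `h0`. -/
theorem lift_invariant (μ : Measure (T × ℂ)) [SFinite μ] (h0 : μ (univ ×ˢ {0}) = 0)
    (hinv : ∀ g : SL2R, μ.map (Prod.map id (linAct g)) = μ) (g : SL2R) (A : Set T) (E : Set SL2R)
    (hA : MeasurableSet A) (hE : MeasurableSet E) :
    (μ.prod volume).map (fun p : (T × ℂ) × ℝ => (p.1.1, colMatrix p.1.2 p.2))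
        (A ×ˢ ((g * ·) ⁻¹' E)) =
      (μ.prod volume).map (fun p : (T × ℂ) × ℝ => (p.1.1, colMatrix p.1.2 p.2)) (A ×ˢ E) := by
  have hmeas : Measurable fun p : (T × ℂ) × ℝ => (p.1.1, colMatrix p.1.2 p.2) :=
    (measurable_fst.comp measurable_fst).prodMk (measurable_colMatrix.comp
      ((measurable_snd.comp measurable_fst).prodMk measurable_snd))
  have hgE : MeasurableSet ((g * ·) ⁻¹' E) := measurable_const_mul g hE
  rw [Measure.map_apply hmeas (hA.prod hgE), Measure.map_apply hmeas (hA.prod hE),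
    Measure.prod_apply (hmeas (hA.prod hgE)), Measure.prod_apply (hmeas (hA.prod hE))]
  conv_rhs => rw [← hinv g]
  rw [lintegral_map (measurable_measure_prodMk_left (hmeas (hA.prod hE)))
    (measurable_id.prodMap (measurable_linAct g))]
  refine lintegral_congr_ae ?_
  filter_upwards [ae_snd_ne_zero h0] with p hp
  have : Prod.mk p ⁻¹' ((fun p : (T × ℂ) × ℝ => (p.1.1, colMatrix p.1.2 p.2)) ⁻¹'
      (A ×ˢ ((g * ·) ⁻¹' E))) = (fun s => s + height (g * colMatrix p.2 0)) ⁻¹'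
      (Prod.mk (Prod.map id (linAct g) p) ⁻¹' ((fun p : (T × ℂ) × ℝ =>
        (p.1.1, colMatrix p.1.2 p.2)) ⁻¹' (A ×ˢ E))) := by
    ext s
    simp only [mem_preimage, mem_prod, Prod.map_fst, Prod.map_snd, id]
    rw [mul_colMatrix g hp]
  rw [this, measure_preimage_add_right]

/-- A measure on `T × ℂ` invariant under `SL(2, ℝ)` is an integral over `T × SL(2, ℝ)`. -/
theorem exists_lintegral_eq (κ : Measure SL2R) [κ.IsHaarMeasure] (μ : Measure (T × ℂ)) [SFinite μ]
    (B : ℕ → Set T) (hB : ∀ n, MeasurableSet (B n)) (hmono : Monotone B)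
    (hcover : ⋃ n, B n = univ) (hfin : ∀ n R, μ (B n ×ˢ Metric.closedBall 0 R) < ∞)
    (h0 : μ (univ ×ˢ {0}) = 0) (hinv : ∀ g : SL2R, μ.map (Prod.map id (linAct g)) = μ) :
    ∃ ν : Measure T, SigmaFinite ν ∧ ∀ F : T × ℂ → ℝ≥0∞, Measurable F →
      ∫⁻ p, F p ∂μ = ∫⁻ a, ∫⁻ g : SL2R, F (a, col₁ g) *
        (Icc (0 : ℝ) 1).indicator 1 (height g) ∂κ ∂ν := by
  have hmeas : Measurable fun p : (T × ℂ) × ℝ => (p.1.1, colMatrix p.1.2 p.2) :=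
    (measurable_fst.comp measurable_fst).prodMk (measurable_colMatrix.comp
      ((measurable_snd.comp measurable_fst).prodMk measurable_snd))
  have hlift : ∀ n, ∀ K : Set SL2R, IsCompact K → (μ.prod volume).map
      (fun p : (T × ℂ) × ℝ => (p.1.1, colMatrix p.1.2 p.2)) (B n ×ˢ K) < ∞ := by
    intro n K hK
    obtain ⟨R, hR⟩ := (hK.image continuous_col₁).isBounded.subset_closedBall 0
    obtain ⟨S, hS⟩ := (hK.image continuous_height).isBounded.subset_closedBall 0
    refine (measure_mono (prod_mono_right subset_closure)).trans_lt ?_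
    rw [hK.isClosed.closure_eq, Measure.map_apply hmeas ((hB n).prod hK.measurableSet)]
    -- At `x = 0` the first column is `1` by convention and does not bound `x`; `max R 0` keeps the
    -- origin in the ball.
    refine (measure_mono (t := (B n ×ˢ Metric.closedBall 0 (max R 0)) ×ˢ Metric.closedBall 0 S)
      ?_).trans_lt ?_
    · rintro ⟨⟨a, x⟩, s⟩ ⟨ha, hx⟩
      refine ⟨⟨ha, ?_⟩, ?_⟩
      · rcases eq_or_ne x 0 with rfl | hx0
        · simp
        · have h1 := hR ⟨_, hx, rfl⟩
          rw [col₁_colMatrix, nonzeroVec_of_ne hx0] at h1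
          exact Metric.closedBall_subset_closedBall (le_max_left _ _) h1
      · have h1 := hS ⟨_, hx, rfl⟩
        rwa [height_colMatrix] at h1
    · rw [Measure.prod_prod]
      exact ENNReal.mul_lt_top (hfin n _) measure_closedBall_lt_top
  obtain ⟨ν, hν, h⟩ := exists_eq_prod_haar κ _ B hB hmono hcover hlift (lift_invariant μ h0 hinv)
  refine ⟨ν, hν, fun F hF => ?_⟩
  -- Restricting the height to `[0, 1]` gives each fibre total mass `1`, so integrating over the
  -- fibres recovers `μ` from its lift.
  have hI : Measurable ((Icc (0 : ℝ) 1).indicator (1 : ℝ → ℝ≥0∞)) :=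
    measurable_one.indicator measurableSet_Icc
  have hG : Measurable fun q : T × SL2R => F (q.1, col₁ q.2) *
      (Icc (0 : ℝ) 1).indicator 1 (height q.2) :=
    (hF.comp (measurable_fst.prodMk (continuous_col₁.measurable.comp measurable_snd))).mul
      (hI.comp (continuous_height.measurable.comp measurable_snd))
  have hG' : Measurable fun p : (T × ℂ) × ℝ => F (p.1.1, col₁ (colMatrix p.1.2 p.2)) *
      (Icc (0 : ℝ) 1).indicator 1 (height (colMatrix p.1.2 p.2)) := hG.comp hmeas
  rw [← lintegral_prod _ hG.aemeasurable, ← h]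
  refine Eq.trans ?_ ((lintegral_map hG hmeas).trans (lintegral_prod _ hG'.aemeasurable)).symm
  refine lintegral_congr_ae ?_
  filter_upwards [ae_snd_ne_zero h0] with p hp
  simp only [height_colMatrix, col₁_colMatrix, nonzeroVec_of_ne hp]
  rw [lintegral_const_mul _ hI, lintegral_indicator_one measurableSet_Icc]
  simp

/-- A measure on `T × ℂ` invariant under `SL(2, ℝ)` and without mass at the origins is a product
with Lebesgue measure. -/
theorem exists_eq_prod_volume (κ : Measure SL2R) [κ.IsHaarMeasure] (μ : Measure (T × ℂ)) [SFinite μ]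
    (B : ℕ → Set T) (hB : ∀ n, MeasurableSet (B n)) (hmono : Monotone B)
    (hcover : ⋃ n, B n = univ) (hfin : ∀ n R, μ (B n ×ˢ Metric.closedBall 0 R) < ∞)
    (h0 : μ (univ ×ˢ {0}) = 0) (hinv : ∀ g : SL2R, μ.map (Prod.map id (linAct g)) = μ) :
    ∃ ν : Measure T, SFinite ν ∧ μ = ν.prod volume := by
  -- Lebesgue measure is itself invariant, so the case `T = Unit` writes it as a constant `ν₀ univ`
  -- times the very functional on the group that represents `μ` on each slice. Comparing the two
  -- formulas eliminates the group.
  obtain ⟨ν₀, -, h₀⟩ := exists_lintegral_eq (T := Unit) κ ((Measure.dirac ()).prod volume)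
    (fun _ => univ) (fun _ => MeasurableSet.univ) monotone_const (iUnion_const _)
    (fun n R => by
      rw [Measure.prod_prod]
      exact ENNReal.mul_lt_top (by simp) measure_closedBall_lt_top)
    (by rw [Measure.prod_prod]; simp)
    (fun g => by
      rw [← Measure.map_prod_map _ _ measurable_id (measurable_linAct g), map_linAct_volume,
        Measure.map_id])
  have hI : Measurable ((Icc (0 : ℝ) 1).indicator (1 : ℝ → ℝ≥0∞)) :=
    measurable_one.indicator measurableSet_Icc
  have hvol : ∀ F : ℂ → ℝ≥0∞, Measurable F → ∫⁻ x, F x = ν₀ univ *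
      ∫⁻ g : SL2R, F (col₁ g) * (Icc (0 : ℝ) 1).indicator 1 (height g) ∂κ := by
    intro F hF
    have h := h₀ (fun p => F p.2) (hF.comp measurable_snd)
    have hF' : Measurable fun p : Unit × ℂ => F p.2 := hF.comp measurable_snd
    rw [lintegral_prod _ hF'.aemeasurable, lintegral_dirac] at h
    exact h.trans ((lintegral_const (∫⁻ g : SL2R, F (col₁ g) *
      (Icc (0 : ℝ) 1).indicator 1 (height g) ∂κ)).trans (mul_comm _ _))
  have hball := hvol ((Metric.ball 0 1).indicator 1)
    (measurable_one.indicator measurableSet_ball)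
  rw [lintegral_indicator_one measurableSet_ball] at hball
  have hpos : (volume : Measure ℂ) (Metric.ball 0 1) ≠ 0 :=
    (Metric.measure_ball_pos _ _ one_pos).ne'
  have hlt : (volume : Measure ℂ) (Metric.ball 0 1) ≠ ∞ := measure_ball_lt_top.ne
  -- The unit ball has positive finite area, so the constant is neither `0` nor `∞` and can be
  -- inverted.
  have hc0 : ν₀ univ ≠ 0 := fun h => hpos (by rw [hball, h, zero_mul])
  have hct : ν₀ univ ≠ ∞ := fun h => by
    rw [h] at hball
    rcases eq_or_ne (∫⁻ g : SL2R, (Metric.ball (0 : ℂ) 1).indicator 1 (col₁ g) *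
      (Icc (0 : ℝ) 1).indicator 1 (height g) ∂κ) 0 with h1 | h1
    · exact hpos (by rw [hball, h1, mul_zero])
    · exact hlt (by rw [hball, ENNReal.top_mul h1])
  obtain ⟨ν, hν, h⟩ := exists_lintegral_eq κ μ B hB hmono hcover hfin h0 hinv
  refine ⟨(ν₀ univ)⁻¹ • ν, inferInstance, Measure.ext_of_lintegral _ fun F hF => ?_⟩
  rw [lintegral_prod _ hF.aemeasurable, lintegral_smul_measure, h F hF, smul_eq_mul,
    ← lintegral_const_mul _ hF.lintegral_prod_right']
  refine lintegral_congr fun a => ?_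
  rw [hvol (fun x => F (a, x)) (hF.comp measurable_prodMk_left), ← mul_assoc,
    ENNReal.inv_mul_cancel hc0 hct, one_mul]

end PlaneProduct

/-! ## Invariant measures on pairs of vectors -/

/-- The determinant of a pair of vectors. -/
def pairDet (p : ℂ × ℂ) : ℝ := p.1.re * p.2.im - p.1.im * p.2.re

theorem measurable_pairDet : Measurable pairDet := by
  unfold pairDet
  fun_prop

/-- The diagonal action on pairs of vectors. -/
def pairAct (g : SL2R) : ℂ × ℂ → ℂ × ℂ := Prod.map (linAct g) (linAct g)

theorem measurable_pairAct (g : SL2R) : Measurable (pairAct g) :=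
  (measurable_linAct g).prodMap (measurable_linAct g)

theorem pairDet_pairAct (g : SL2R) (p : ℂ × ℂ) : pairDet (pairAct g p) = pairDet p := by
  simp only [pairDet, pairAct, Prod.map_fst, Prod.map_snd, linAct_apply]
  linear_combination (p.1.re * p.2.im - p.1.im * p.2.re) * det_eq g

theorem linAct_ofReal_mul (g : SL2R) (a : ℝ) (x : ℂ) : linAct g (a * x) = a * linAct g x := by
  rw [← Complex.real_smul, map_smul, Complex.real_smul]

theorem linAct_ne_zero (g : SL2R) {x : ℂ} (hx : x ≠ 0) : linAct g x ≠ 0 := by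
  intro h
  apply hx
  rw [← linAct_one x, ← inv_mul_cancel g, linAct_mul, h, map_zero]

/-- The pair `p`, with degenerate pairs replaced by the standard basis. -/
def framePair (p : ℂ × ℂ) : ℂ × ℂ := if pairDet p = 0 then (1, Complex.I) else p

theorem framePair_of_ne {p : ℂ × ℂ} (hp : pairDet p ≠ 0) : framePair p = p := if_neg hp

theorem pairDet_framePair (p : ℂ × ℂ) : pairDet (framePair p) ≠ 0 := by
  unfold framePair
  split_ifs with h
  · simp [pairDet]
  · exact h

theorem measurable_framePair : Measurable framePair :=
  Measurable.ite (measurable_pairDet (measurableSet_singleton 0)) measurable_const measurable_id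

/-- The coordinates `(t, g)` of the pair `(t x, y)`, where `g` has columns `x` and `y`. -/
def pairCoord (p : ℂ × ℂ) : {t : ℝ // t ≠ 0} × SL2R :=
  (⟨pairDet (framePair p), pairDet_framePair p⟩,
    ⟨!![(framePair p).1.re / pairDet (framePair p), (framePair p).2.re;
        (framePair p).1.im / pairDet (framePair p), (framePair p).2.im], by
      have h := pairDet_framePair p
      rw [Matrix.det_fin_two_of]
      field_simp
      rw [pairDet]
      ring⟩)

/-- The pair `(t x, y)`, where `x` and `y` are the columns of `g`. -/
def pairOfCoord (q : {t : ℝ // t ≠ 0} × SL2R) : ℂ × ℂ :=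
  ((q.1.1 : ℂ) * col₁ q.2, col₂ q.2)

theorem measurable_pairOfCoord : Measurable pairOfCoord :=
  ((Complex.measurable_ofReal.comp (measurable_subtype_coe.comp measurable_fst)).mul
    (continuous_col₁.measurable.comp measurable_snd)).prodMk
    (continuous_col₂.measurable.comp measurable_snd)

theorem pairOfCoord_mul (t : {t : ℝ // t ≠ 0}) (g k : SL2R) :
    pairOfCoord (t, g * k) = pairAct g (pairOfCoord (t, k)) := by
  simp only [pairOfCoord, pairAct, Prod.map, col₁_mul, col₂_mul, linAct_ofReal_mul]

theorem pairDet_pairOfCoord (q : {t : ℝ // t ≠ 0} × SL2R) : pairDet (pairOfCoord q) = q.1.1 := by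
  simp only [pairDet, pairOfCoord, col₁, col₂, Complex.re_ofReal_mul, Complex.im_ofReal_mul]
  linear_combination q.1.1 * det_eq q.2

theorem pairOfCoord_injective : Function.Injective pairOfCoord := by
  rintro ⟨t, g⟩ ⟨s, k⟩ h
  have hts : t = s := Subtype.ext (by
    rw [← pairDet_pairOfCoord (t, g), h, pairDet_pairOfCoord])
  subst hts
  have ht : (t.1 : ℂ) ≠ 0 := Complex.ofReal_ne_zero.2 t.2
  exact Prod.ext rfl (SL2R_ext (mul_left_cancel₀ ht (congrArg Prod.fst h)) (congrArg Prod.snd h))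

theorem pairOfCoord_pairCoord (p : ℂ × ℂ) : pairOfCoord (pairCoord p) = framePair p := by
  have h := pairDet_framePair p
  refine Prod.ext ?_ rfl
  apply Complex.ext
  · simp only [pairOfCoord, pairCoord, col₁, Complex.re_ofReal_mul, Matrix.of_apply,
      Matrix.cons_val', Matrix.cons_val_zero, Matrix.cons_val_fin_one]
    field_simp
  · simp only [pairOfCoord, pairCoord, col₁, Complex.im_ofReal_mul, Matrix.of_apply,
      Matrix.cons_val', Matrix.cons_val_zero, Matrix.cons_val_one, Matrix.cons_val_fin_one]
    field_simp

/-- The determinant is invariant, and in these coordinates the diagonal action becomes left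
translation. -/
theorem pairCoord_pairAct (g : SL2R) {p : ℂ × ℂ} (hp : pairDet p ≠ 0) :
    pairCoord (pairAct g p) = ((pairCoord p).1, g * (pairCoord p).2) := by
  apply pairOfCoord_injective
  rw [pairOfCoord_pairCoord, pairOfCoord_mul, pairOfCoord_pairCoord, framePair_of_ne hp,
    framePair_of_ne (by rwa [pairDet_pairAct])]

theorem measurable_pairCoord : Measurable pairCoord := by
  have hd : Measurable fun p => pairDet (framePair p) :=
    measurable_pairDet.comp measurable_framePair
  have h1 := Complex.measurable_re.comp (measurable_fst.comp measurable_framePair)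
  have h2 := Complex.measurable_im.comp (measurable_fst.comp measurable_framePair)
  have h3 := Complex.measurable_re.comp (measurable_snd.comp measurable_framePair)
  have h4 := Complex.measurable_im.comp (measurable_snd.comp measurable_framePair)
  refine (hd.subtype_mk).prodMk (measurable_SL2R fun i j => ?_)
  fin_cases i <;> fin_cases j
  · exact h1.div hd
  · exact h3
  · exact h2.div hd
  · exact h4

/-! ### Parallel pairs and the decomposition along orbits. -/

/-- The ratio of two parallel vectors. -/
def slope (p : ℂ × ℂ) : ℝ :=
  (p.1.re * p.2.re + p.1.im * p.2.im) / (p.1.re ^ 2 + p.1.im ^ 2)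

theorem measurable_slope : Measurable slope := by
  unfold slope
  fun_prop

theorem slope_mul {x : ℂ} (hx : x ≠ 0) (a : ℝ) : slope (x, a * x) = a := by
  have h := sq_add_sq_ne_zero hx
  simp only [slope, Complex.re_ofReal_mul, Complex.im_ofReal_mul]
  field_simp

theorem eq_slope_mul {p : ℂ × ℂ} (hp : pairDet p = 0) (h0 : p.1 ≠ 0) : p.2 = slope p * p.1 := by
  have h := sq_add_sq_ne_zero h0
  rw [pairDet] at hp
  apply Complex.ext
  · simp only [slope, Complex.re_ofReal_mul]
    field_simp
    linear_combination -p.1.im * hp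
  · simp only [slope, Complex.im_ofReal_mul]
    field_simp
    linear_combination p.1.re * hp

theorem slope_pairAct (g : SL2R) {p : ℂ × ℂ} (hp : pairDet p = 0) (h0 : p.1 ≠ 0) :
    slope (pairAct g p) = slope p := by
  have h : pairAct g p = (linAct g p.1, slope p * linAct g p.1) := by
    refine Prod.ext rfl ?_
    rw [← linAct_ofReal_mul, ← eq_slope_mul hp h0]
    rfl
  rw [h, slope_mul (linAct_ne_zero g h0)]

/-- In the coordinates `(t, g)` invariance of `M` is left invariance in `g`, so
`exists_eq_prod_haar` applies. -/
theorem exists_restrict_eq_map_prod_haar (κ : Measure SL2R) [κ.IsHaarMeasure]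
    (M : Measure (ℂ × ℂ)) (hfin : ∀ R, M (Metric.closedBall 0 R) < ∞)
    (hinv : ∀ g : SL2R, M.map (pairAct g) = M) :
    ∃ ν : Measure {t : ℝ // t ≠ 0}, SFinite ν ∧
      M.restrict {p | pairDet p ≠ 0} = (ν.prod κ).map pairOfCoord := by
  have hD : MeasurableSet {p | pairDet p ≠ 0} :=
    measurable_pairDet (measurableSet_singleton 0).compl
  obtain ⟨ν, hν, h⟩ := exists_eq_prod_haar κ ((M.restrict {p | pairDet p ≠ 0}).map pairCoord)
    (fun n => {t | |t.1| ≤ n})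
    (fun n => measurableSet_le (by fun_prop) measurable_const)
    (fun i j hij t ht => le_trans (show |t.1| ≤ i from ht) (by exact_mod_cast hij))
    (by
      ext t
      simpa using exists_nat_ge |t.1|)
    (by
      intro n K hK
      obtain ⟨R₁, h₁⟩ := (hK.image continuous_col₁).isBounded.subset_closedBall 0
      obtain ⟨R₂, h₂⟩ := (hK.image continuous_col₂).isBounded.subset_closedBall 0
      rw [Measure.map_apply measurable_pairCoord ((measurableSet_le (by fun_prop)
        measurable_const).prod hK.measurableSet),
        Measure.restrict_apply' hD]
      -- A bound on `|t|` and on the columns bounds `(t x, y)`. No lower bound on `|t|` is needed,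
      -- so the sets `|t| ≤ n` serve as the exhaustion.
      refine (measure_mono ?_).trans_lt (hfin (max (n * R₁) R₂))
      rintro p ⟨⟨ht, hg⟩, hp⟩
      have hpq := pairOfCoord_pairCoord p
      rw [framePair_of_ne hp] at hpq
      rw [← hpq, mem_closedBall_zero_iff, pairOfCoord, Prod.norm_mk]
      refine max_le_max ?_ ?_
      · rw [norm_mul, Complex.norm_real, Real.norm_eq_abs]
        have : ‖col₁ (pairCoord p).2‖ ≤ R₁ := by simpa using h₁ ⟨_, hg, rfl⟩
        exact mul_le_mul ht this (norm_nonneg _) (Nat.cast_nonneg n)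
      · simpa using h₂ ⟨_, hg, rfl⟩)
    (by
      intro g A E hA hE
      rw [Measure.map_apply measurable_pairCoord (hA.prod (measurable_const_mul g hE)),
        Measure.map_apply measurable_pairCoord (hA.prod hE), Measure.restrict_apply' hD,
        Measure.restrict_apply' hD]
      conv_rhs => rw [← hinv g, Measure.map_apply (measurable_pairAct g)
        ((measurable_pairCoord (hA.prod hE)).inter hD)]
      congr 1
      ext p
      simp only [mem_inter_iff, mem_preimage, mem_prod, mem_ofPred_eq, pairDet_pairAct]
      refine and_congr_left fun hp => ?_
      rw [pairCoord_pairAct g hp])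
  refine ⟨ν, inferInstance, ?_⟩
  rw [← h, Measure.map_map measurable_pairOfCoord measurable_pairCoord]
  conv_lhs => rw [← Measure.map_id (μ := M.restrict {p | pairDet p ≠ 0})]
  refine Measure.map_congr ?_
  filter_upwards [ae_restrict_mem hD] with p hp
  rw [Function.comp_apply, pairOfCoord_pairCoord, framePair_of_ne hp, id]

/-- By `h0` almost every parallel pair is `(x, s x)` with `x ≠ 0`. The slope `s` is invariant and
the action on `x` is linear, so `exists_eq_prod_volume` applies in the coordinates `(s, x)`. -/
theorem exists_restrict_eq_map_prod_volume (κ : Measure SL2R) [κ.IsHaarMeasure]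
    (M : Measure (ℂ × ℂ)) [SFinite M]
    (hfin : ∀ R, M (Metric.closedBall 0 R) < ∞) (h0 : M ({0} ×ˢ univ) = 0)
    (hinv : ∀ g : SL2R, M.map (pairAct g) = M) :
    ∃ η : Measure ℝ, SFinite η ∧ M.restrict {p | pairDet p ≠ 0}ᶜ =
      (η.prod volume).map (fun q : ℝ × ℂ => (q.2, (q.1 : ℂ) * q.2)) := by
  have hD : MeasurableSet {p | pairDet p ≠ 0} :=
    measurable_pairDet (measurableSet_singleton 0).compl
  have hsm : Measurable fun p : ℂ × ℂ => (slope p, p.1) := measurable_slope.prodMk measurable_fst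
  have hae : ∀ᵐ p ∂M.restrict {p | pairDet p ≠ 0}ᶜ, pairDet p = 0 ∧ p.1 ≠ 0 := by
    refine (ae_restrict_iff' hD.compl).2 ?_
    have : ∀ᵐ p ∂M, p.1 ≠ 0 := by
      rw [ae_iff]
      convert h0 using 2
      ext p
      simp
    filter_upwards [this] with p hp hpD
    exact ⟨by simpa using hpD, hp⟩
  have hres : ∀ g, (M.restrict {p | pairDet p ≠ 0}ᶜ).map (pairAct g) =
      M.restrict {p | pairDet p ≠ 0}ᶜ := by
    intro g
    conv_rhs => rw [← hinv g, Measure.restrict_map (measurable_pairAct g) hD.compl]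
    congr 2
    ext p
    simp [pairDet_pairAct]
  obtain ⟨η, hη, h⟩ := exists_eq_prod_volume κ
    ((M.restrict {p | pairDet p ≠ 0}ᶜ).map fun p => (slope p, p.1)) (fun n => Metric.closedBall 0 n)
    (fun n => Metric.isClosed_closedBall.measurableSet)
    (fun i j hij => Metric.closedBall_subset_closedBall (by exact_mod_cast hij))
    (Metric.iUnion_closedBall_nat 0)
    (by
      intro n R
      rw [Measure.map_apply hsm (Metric.isClosed_closedBall.measurableSet.prod
        Metric.isClosed_closedBall.measurableSet)]
      have hsub : ∀ᵐ p ∂M.restrict {p | pairDet p ≠ 0}ᶜ,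
          p ∈ (fun p : ℂ × ℂ => (slope p, p.1)) ⁻¹'
            (Metric.closedBall 0 (n : ℝ) ×ˢ Metric.closedBall 0 R) →
          p ∈ Metric.closedBall (0 : ℂ × ℂ) (max R (n * R)) := by
        filter_upwards [hae] with p hp hmem
        obtain ⟨h1, h2⟩ := hmem
        simp only [mem_closedBall_zero_iff] at h1 h2
        rw [mem_closedBall_zero_iff, Prod.norm_def]
        refine max_le_max h2 ?_
        rw [eq_slope_mul hp.1 hp.2, norm_mul, Complex.norm_real]
        exact mul_le_mul h1 h2 (norm_nonneg _) (Nat.cast_nonneg n)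
      exact ((measure_mono_ae hsub).trans (Measure.restrict_apply_le _ _)).trans_lt (hfin _))
    (by
      rw [Measure.map_apply hsm (MeasurableSet.univ.prod (measurableSet_singleton 0)),
        measure_eq_zero_iff_ae_notMem]
      filter_upwards [hae] with p hp hmem
      exact hp.2 hmem.2)
    (by
      intro g
      conv_rhs => rw [← hres g, Measure.map_map hsm (measurable_pairAct g)]
      rw [Measure.map_map (measurable_id.prodMap (measurable_linAct g)) hsm]
      refine Measure.map_congr ?_
      filter_upwards [hae] with p hp
      simp only [Function.comp_apply, slope_pairAct g hp.1 hp.2]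
      rfl)
  refine ⟨η, hη, ?_⟩
  have hΨ : Measurable fun q : ℝ × ℂ => (q.2, (q.1 : ℂ) * q.2) := by fun_prop
  rw [← h, Measure.map_map hΨ hsm]
  conv_lhs => rw [← Measure.map_id (μ := M.restrict {p | pairDet p ≠ 0}ᶜ)]
  refine Measure.map_congr ?_
  filter_upwards [hae] with p hp
  exact Prod.ext rfl (eq_slope_mul hp.1 hp.2)

/-- Decomposition of an invariant measure on pairs of vectors along the orbits of `SL(2, ℝ)`. -/
theorem exists_orbit_decomposition (κ : Measure SL2R) [κ.IsHaarMeasure]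
    (M : Measure (ℂ × ℂ)) (hfin : ∀ R, M (Metric.closedBall 0 R) < ∞)
    (h0 : M ({0} ×ˢ univ) = 0) (hinv : ∀ g : SL2R, M.map (pairAct g) = M) :
    ∃ (ν : Measure {t : ℝ // t ≠ 0}) (η : Measure ℝ), SFinite ν ∧ SFinite η ∧
      M = (ν.prod κ).map pairOfCoord +
        (η.prod volume).map (fun q : ℝ × ℂ => (q.2, (q.1 : ℂ) * q.2)) := by
  have : SigmaFinite M := ⟨⟨⟨fun n : ℕ => Metric.closedBall 0 n, fun _ => trivial,
    fun n => hfin n, Metric.iUnion_closedBall_nat 0⟩⟩⟩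
  obtain ⟨ν, hν, h₁⟩ := exists_restrict_eq_map_prod_haar κ M hfin hinv
  obtain ⟨η, hη, h₂⟩ := exists_restrict_eq_map_prod_volume κ M hfin h0 hinv
  refine ⟨ν, η, hν, hη, ?_⟩
  rw [← h₁, ← h₂]
  exact (Measure.restrict_add_restrict_compl
    (measurable_pairDet (measurableSet_singleton 0).compl)).symm

/-! ## The measure on pairs of vectors defined by an invariant measure on surfaces -/

section PairMeasure

variable {k : Multiset ℕ} {c : Stratum k}

/-- The counting measure on pairs of holonomy vectors. -/
def pairCount (x : AreaOne c) : Measure (ℂ × ℂ) :=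
  Measure.sum fun v : Stratum.holonomy x.1 × Stratum.holonomy x.1 =>
    Measure.dirac ((v.1 : ℂ), (v.2 : ℂ))

theorem lintegral_pairCount (x : AreaOne c) {F : ℂ × ℂ → ℝ≥0∞} (hF : Measurable F) :
    ∫⁻ p, F p ∂pairCount x =
      ∑' v : Stratum.holonomy x.1 × Stratum.holonomy x.1, F (v.1, v.2) := by
  rw [pairCount, lintegral_sum_measure]
  exact tsum_congr fun v => lintegral_dirac' _ hF

theorem pairCount_apply (x : AreaOne c) {E : Set (ℂ × ℂ)} (hE : MeasurableSet E) :
    pairCount x E = ∑' v : Stratum.holonomy x.1 × Stratum.holonomy x.1,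
      E.indicator 1 ((v.1 : ℂ), (v.2 : ℂ)) := by
  rw [← lintegral_pairCount x (measurable_one.indicator hE), lintegral_indicator_one hE]

/-! ### Finiteness and measurability of the counts. -/

theorem finite_support_holonomy {x : AreaOne c} {A : Type*} [Zero A] {f : ℂ → A} {R : ℝ}
    (hf : ∀ v, f v ≠ 0 → ‖v‖ ≤ R) :
    (Function.support fun v : Stratum.holonomy x.1 => f v).Finite := by
  refine Finite.of_finite_image (f := Subtype.val)
    ((x.1.finite_holonomy_inter_closedBall R).subset ?_) Subtype.val_injective.injOn
  rintro _ ⟨v, hv, rfl⟩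
  exact ⟨v.2, mem_closedBall_zero_iff.2 (hf _ hv)⟩

theorem finite_support_holonomy_pair {x : AreaOne c} {A : Type*} [Zero A] {f : ℂ × ℂ → A} {R : ℝ}
    (hf : ∀ p, f p ≠ 0 → ‖p‖ ≤ R) :
    (Function.support fun v : Stratum.holonomy x.1 × Stratum.holonomy x.1 =>
      f (v.1, v.2)).Finite := by
  have h := (x.1.finite_holonomy_inter_closedBall R)
  refine Finite.of_finite_image (f := Prod.map Subtype.val Subtype.val)
    ((h.prod h).subset ?_) (Subtype.val_injective.prodMap Subtype.val_injective).injOn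
  rintro _ ⟨v, hv, rfl⟩
  have hn := hf _ hv
  exact ⟨⟨v.1.2, mem_closedBall_zero_iff.2 ((norm_fst_le _).trans hn)⟩,
    ⟨v.2.2, mem_closedBall_zero_iff.2 ((norm_snd_le _).trans hn)⟩⟩

theorem isBc_indicator {A : Set ℂ} (hA : MeasurableSet A) {R : ℝ}
    (hAR : A ⊆ Metric.closedBall 0 R) : IsBc (A.indicator (1 : ℂ → ℝ)) := by
  refine ⟨measurable_one.indicator hA, ⟨1, fun x => ?_⟩, ?_⟩
  · by_cases hx : x ∈ A <;> simp [hx]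
  · exact HasCompactSupport.of_support_subset_isCompact (isCompact_closedBall 0 R)
      ((support_indicator_subset).trans hAR)

/-- The number of holonomy vectors in a bounded set is a Siegel-Veech transform. -/
theorem ofReal_transform_indicator (x : AreaOne c) {A : Set ℂ} {R : ℝ}
    (hAR : A ⊆ Metric.closedBall 0 R) :
    ENNReal.ofReal (transform (A.indicator 1) x) =
      ∑' v : Stratum.holonomy x.1, A.indicator 1 (v : ℂ) := by
  rw [transform, ENNReal.ofReal_tsum_of_nonneg]
  · refine tsum_congr fun v => ?_
    by_cases hv : (v : ℂ) ∈ A <;> simp [hv]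
  · exact fun v => indicator_nonneg (fun _ _ => zero_le_one) _
  -- Local finiteness matters here: a real `tsum` over a non-summable family is `0` and would not
  -- count the vectors.
  · refine summable_of_hasFiniteSupport (finite_support_holonomy (R := R) fun v hv => ?_)
    exact mem_closedBall_zero_iff.1 (hAR (mem_of_indicator_ne_zero hv))

/-- The double sum over a rectangle factors. This is how a hypothesis on transforms over `ℝ²`
controls pairs. -/
theorem pairCount_prod (x : AreaOne c) {A B : Set ℂ} (hA : MeasurableSet A) (hB : MeasurableSet B)
    {R : ℝ} (hAR : A ⊆ Metric.closedBall 0 R) (hBR : B ⊆ Metric.closedBall 0 R) :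
    pairCount x (A ×ˢ B) = ENNReal.ofReal (transform (A.indicator 1) x) *
      ENNReal.ofReal (transform (B.indicator 1) x) := by
  rw [pairCount_apply x (hA.prod hB), ofReal_transform_indicator x hAR,
    ofReal_transform_indicator x hBR, ← ENNReal.tsum_mul_right]
  refine (ENNReal.tsum_prod (f := fun v w : Stratum.holonomy x.1 =>
    (A ×ˢ B).indicator (1 : ℂ × ℂ → ℝ≥0∞) ((v : ℂ), (w : ℂ)))).trans ?_
  refine tsum_congr fun v => ?_
  rw [← ENNReal.tsum_mul_left]
  refine tsum_congr fun w => ?_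
  by_cases hv : (v : ℂ) ∈ A <;> by_cases hw : (w : ℂ) ∈ B <;> simp [hv, hw]

variable {lam : Measure (AreaOne c)}

/-- Bounded rectangles follow from `pairCount_prod` and the a.e. measurability contained in `hL2`.
Rectangles generate the Borel sets, and truncation to balls keeps the counts finite, so complements
become subtractions; increasing balls then remove the truncation. -/
theorem aemeasurable_pairCount
    (hL2 : ∀ f : ℂ → ℝ, IsBc f → MemLp (fun x : AreaOne c => transform f x) 2 lam)
    {E : Set (ℂ × ℂ)} (hE : MeasurableSet E) :
    AEMeasurable (fun x : AreaOne c => pairCount x E) lam := by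
  have hball : ∀ n : ℕ, MeasurableSet (Metric.closedBall (0 : ℂ) n ×ˢ Metric.closedBall (0 : ℂ) n) :=
    fun n => Metric.isClosed_closedBall.measurableSet.prod Metric.isClosed_closedBall.measurableSet
  have hrect : ∀ (n : ℕ) (A B : Set ℂ), MeasurableSet A → MeasurableSet B →
      AEMeasurable (fun x : AreaOne c => pairCount x
        ((A ×ˢ B) ∩ (Metric.closedBall 0 n ×ˢ Metric.closedBall 0 n))) lam := by
    intro n A B hA hB
    have hA' := hA.inter (Metric.isClosed_closedBall (x := (0 : ℂ)) (ε := n)).measurableSet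
    have hB' := hB.inter (Metric.isClosed_closedBall (x := (0 : ℂ)) (ε := n)).measurableSet
    simp only [prod_inter_prod, pairCount_prod _ hA' hB' inter_subset_right inter_subset_right]
    exact ((hL2 _ (isBc_indicator hA' inter_subset_right)).1.aemeasurable.ennreal_ofReal).mul
      ((hL2 _ (isBc_indicator hB' inter_subset_right)).1.aemeasurable.ennreal_ofReal)
  have hbdd : ∀ n : ℕ, AEMeasurable (fun x : AreaOne c => pairCount x
      (E ∩ (Metric.closedBall 0 n ×ˢ Metric.closedBall 0 n))) lam := by
    intro n
    have hfinite : ∀ x : AreaOne c,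
        pairCount x (Metric.closedBall 0 n ×ˢ Metric.closedBall 0 n) ≠ ∞ := fun x => by
      rw [pairCount_prod x Metric.isClosed_closedBall.measurableSet
        Metric.isClosed_closedBall.measurableSet subset_rfl subset_rfl]
      exact ENNReal.mul_ne_top ENNReal.ofReal_ne_top ENNReal.ofReal_ne_top
    induction E, hE using MeasurableSpace.induction_on_inter generateFrom_prod.symm isPiSystem_prod
      with
    | empty => simp
    | basic E hE =>
      obtain ⟨A, hA, B, hB, rfl⟩ := hE
      exact hrect n A B hA hB
    | compl E hE ih =>
      have h : ∀ x : AreaOne c, pairCount x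
          (Eᶜ ∩ (Metric.closedBall 0 n ×ˢ Metric.closedBall 0 n)) =
          pairCount x ((univ ×ˢ univ) ∩ (Metric.closedBall 0 n ×ˢ Metric.closedBall 0 n)) -
          pairCount x (E ∩ (Metric.closedBall 0 n ×ˢ Metric.closedBall 0 n)) := by
        intro x
        rw [univ_prod_univ, univ_inter, ← measure_sdiff inter_subset_right
          (hE.inter (hball n)).nullMeasurableSet
          (measure_ne_top_of_subset inter_subset_right (hfinite x))]
        congr 1
        ext p
        simp only [mem_inter_iff, mem_compl_iff, Set.mem_sdiff]
        tauto
      simp only [h]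
      exact (hrect n _ _ MeasurableSet.univ MeasurableSet.univ).sub ih
    | iUnion f hd hf ih =>
      have h : ∀ x : AreaOne c, pairCount x
          ((⋃ i, f i) ∩ (Metric.closedBall 0 n ×ˢ Metric.closedBall 0 n)) =
          ∑' i, pairCount x (f i ∩ (Metric.closedBall 0 n ×ˢ Metric.closedBall 0 n)) := by
        intro x
        rw [iUnion_inter, measure_iUnion
          (fun i j hij => (hd hij).mono inter_subset_left inter_subset_left)
          fun i => (hf i).inter (hball n)]
      simp only [h]
      exact AEMeasurable.tsum ih
  have h : ∀ x : AreaOne c, pairCount x E = ⨆ n : ℕ, pairCount x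
      (E ∩ (Metric.closedBall 0 n ×ˢ Metric.closedBall 0 n)) := by
    intro x
    have hmono : Monotone fun n : ℕ =>
        E ∩ (Metric.closedBall (0 : ℂ) n ×ˢ Metric.closedBall (0 : ℂ) n) := fun i j hij => by
      have := Metric.closedBall_subset_closedBall (x := (0 : ℂ))
        (show (i : ℝ) ≤ j by exact_mod_cast hij)
      exact inter_subset_inter_right _ (prod_mono this this)
    rw [← hmono.measure_iUnion, ← inter_iUnion]
    congr 1
    have : (⋃ n : ℕ, Metric.closedBall (0 : ℂ) n ×ˢ Metric.closedBall (0 : ℂ) n) = univ := by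
      simp only [closedBall_prod_same]
      exact Metric.iUnion_closedBall_nat _
    rw [this, inter_univ]
  simp only [h]
  exact AEMeasurable.iSup hbdd

/-- The measure `∫ Σ δ_(v, w) dλ` on pairs of vectors. -/
def pairMeasure (lam : Measure (AreaOne c))
    (hL2 : ∀ f : ℂ → ℝ, IsBc f → MemLp (fun x : AreaOne c => transform f x) 2 lam) :
    Measure (ℂ × ℂ) :=
  Measure.ofMeasurable (fun E _ => ∫⁻ x, pairCount x E ∂lam) (by simp) (by
    intro f hf hd
    rw [← lintegral_tsum fun i => aemeasurable_pairCount hL2 (hf i)]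
    exact lintegral_congr fun x => measure_iUnion hd hf)

variable (hL2 : ∀ f : ℂ → ℝ, IsBc f → MemLp (fun x : AreaOne c => transform f x) 2 lam)

theorem pairMeasure_apply {E : Set (ℂ × ℂ)} (hE : MeasurableSet E) :
    pairMeasure lam hL2 E = ∫⁻ x, pairCount x E ∂lam :=
  Measure.ofMeasurable_apply E hE

/-- Indicators, then sums, then increasing limits. The a.e. measurability is part of the induction
because the last two steps use it. -/
theorem lintegral_pairMeasure {F : ℂ × ℂ → ℝ≥0∞} (hF : Measurable F) :
    AEMeasurable (fun x : AreaOne c => ∫⁻ p, F p ∂pairCount x) lam ∧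
      ∫⁻ p, F p ∂pairMeasure lam hL2 = ∫⁻ x, ∫⁻ p, F p ∂pairCount x ∂lam := by
  refine Measurable.ennreal_induction (motive := fun F : ℂ × ℂ → ℝ≥0∞ =>
    AEMeasurable (fun x : AreaOne c => ∫⁻ p, F p ∂pairCount x) lam ∧
      ∫⁻ p, F p ∂pairMeasure lam hL2 = ∫⁻ x, ∫⁻ p, F p ∂pairCount x ∂lam) ?_ ?_ ?_ hF
  · intro a E hE
    simp only [lintegral_indicator_const hE]
    refine ⟨(aemeasurable_pairCount hL2 hE).const_mul a, ?_⟩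
    rw [pairMeasure_apply hL2 hE, lintegral_const_mul'' _ (aemeasurable_pairCount hL2 hE)]
  · intro f g _ hf hg ihf ihg
    simp only [Pi.add_apply, lintegral_add_left hf]
    refine ⟨ihf.1.add ihg.1, ?_⟩
    rw [ihf.2, ihg.2, lintegral_add_left' ihf.1]
  · intro f hf hmono ih
    simp only [lintegral_iSup hf hmono]
    refine ⟨AEMeasurable.iSup fun n => (ih n).1, ?_⟩
    rw [lintegral_iSup' (fun n => (ih n).1)
      (ae_of_all _ fun x i j hij => lintegral_mono (hmono hij))]
    exact iSup_congr fun n => (ih n).2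

/-- A ball for the sup norm is a product of discs, so its mass is the integral of a squared
transform. Square integrability enters here. -/
theorem pairMeasure_closedBall_lt_top (R : ℝ) :
    pairMeasure lam hL2 (Metric.closedBall 0 R) < ∞ := by
  have hm : MeasurableSet (Metric.closedBall (0 : ℂ) R) := Metric.isClosed_closedBall.measurableSet
  have h := (hL2 _ (isBc_indicator hm subset_rfl)).integrable_sq
  rw [pairMeasure_apply hL2 Metric.isClosed_closedBall.measurableSet]
  refine lt_of_le_of_lt (lintegral_mono fun x => ?_) h.2
  change pairCount x (Metric.closedBall ((0 : ℂ), (0 : ℂ)) R) ≤ _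
  rw [← closedBall_prod_same, pairCount_prod x hm hm subset_rfl subset_rfl, Real.enorm_eq_ofReal
    (sq_nonneg _), sq, ENNReal.ofReal_mul]
  exact tsum_nonneg fun v => indicator_nonneg (fun _ _ => zero_le_one) _

theorem pairMeasure_zero_prod : pairMeasure lam hL2 ({0} ×ˢ univ) = 0 := by
  have hm : MeasurableSet (({0} : Set ℂ) ×ˢ (univ : Set ℂ)) :=
    (measurableSet_singleton 0).prod MeasurableSet.univ
  rw [pairMeasure_apply hL2 hm]
  refine (lintegral_congr fun x => ?_).trans lintegral_zero
  rw [pairCount_apply x hm]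
  refine ENNReal.tsum_eq_zero.2 fun v => indicator_of_notMem (fun h => ?_) _
  have h0 : (v.1 : ℂ) = 0 := h.1
  exact x.1.zero_notMem_holonomy (h0 ▸ v.1.2)

/-- Reindexing of the sum by `holonomyEquiv` in both factors. -/
theorem map_pairCount (g : SL2R) (x : AreaOne c) :
    (pairCount x).map (pairAct g) = pairCount (g • x) := by
  refine Measure.ext fun E hE => ?_
  rw [Measure.map_apply (measurable_pairAct g) hE, pairCount_apply _ hE,
    pairCount_apply x (measurable_pairAct g hE)]
  exact ((Equiv.prodCongr (Stratum.holonomyEquiv g x.1) (Stratum.holonomyEquiv g x.1)).tsum_eq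
    fun v : Stratum.holonomy (g • x.1) × Stratum.holonomy (g • x.1) =>
      E.indicator (1 : ℂ × ℂ → ℝ≥0∞) ((v.1 : ℂ), (v.2 : ℂ)))

theorem map_pairMeasure
    (hinv : ∀ g : SL2R, MeasurePreserving (fun x : AreaOne c => g • x) lam lam) (g : SL2R) :
    (pairMeasure lam hL2).map (pairAct g) = pairMeasure lam hL2 := by
  refine Measure.ext fun E hE => ?_
  have hae : AEMeasurable (fun x : AreaOne c => pairCount x E)
      (lam.map fun x : AreaOne c => g • x) := by
    rw [(hinv g).map_eq]
    exact aemeasurable_pairCount hL2 hE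
  rw [Measure.map_apply (measurable_pairAct g) hE, pairMeasure_apply hL2 hE,
    pairMeasure_apply hL2 (measurable_pairAct g hE)]
  conv_rhs => rw [← (hinv g).map_eq, lintegral_map' hae (hinv g).aemeasurable]
  refine lintegral_congr fun x => ?_
  rw [← map_pairCount, Measure.map_apply (measurable_pairAct g) hE]

/-! ## Transforms of functions on pairs of vectors -/

theorem exists_norm_le_of_isBc {E : Type} [NormedAddCommGroup E] [MeasurableSpace E] {f : E → ℝ}
    (hf : IsBc f) : ∃ R, ∀ p, f p ≠ 0 → ‖p‖ ≤ R := by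
  obtain ⟨R, hR⟩ := hf.compactSupport.isCompact.isBounded.subset_closedBall 0
  exact ⟨R, fun p hp => mem_closedBall_zero_iff.1 (hR (subset_tsupport f hp))⟩

theorem integrable_of_isBc {E : Type} [NormedAddCommGroup E] [MeasurableSpace E] [BorelSpace E]
    {m : Measure E} (hfin : ∀ R, m (Metric.closedBall 0 R) < ∞) {f : E → ℝ} (hf : IsBc f) :
    Integrable f m := by
  obtain ⟨R, hR⟩ := exists_norm_le_of_isBc hf
  obtain ⟨C, hC⟩ := hf.bounded
  have hs : Function.support f ⊆ Metric.closedBall 0 R := fun p hp =>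
    mem_closedBall_zero_iff.2 (hR p hp)
  refine (integrableOn_iff_integrable_of_support_subset hs).1 ?_
  exact Measure.integrableOn_of_bounded (hfin R).ne hf.measurable.aestronglyMeasurable
    (ae_of_all _ hC)

/-- The positive and negative parts of `h` are treated separately as `ℝ≥0∞`-valued integrals, finite
because `h` is integrable for `pairMeasure`. For each surface the sums have finite support, so they
may be subtracted. -/
theorem integral_transform₂ {h : ℂ × ℂ → ℝ} (hh : IsBc h) :
    Integrable (fun x : AreaOne c => transform₂ h x) lam ∧
      ∫ x : AreaOne c, transform₂ h x ∂lam = ∫ p, h p ∂pairMeasure lam hL2 := by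
  have hint := integrable_of_isBc (pairMeasure_closedBall_lt_top hL2) hh
  obtain ⟨R, hR⟩ := exists_norm_le_of_isBc hh
  have hp : Measurable fun p => ENNReal.ofReal (h p) := hh.measurable.ennreal_ofReal
  have hn : Measurable fun p => ENNReal.ofReal (-h p) := hh.measurable.neg.ennreal_ofReal
  obtain ⟨hpm, hpe⟩ := lintegral_pairMeasure hL2 hp
  obtain ⟨hnm, hne⟩ := lintegral_pairMeasure hL2 hn
  have hpt : ∫⁻ x, ∫⁻ p, ENNReal.ofReal (h p) ∂pairCount x ∂lam ≠ ∞ := by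
    rw [← hpe]
    exact hint.lintegral_lt_top.ne
  have hnt : ∫⁻ x, ∫⁻ p, ENNReal.ofReal (-h p) ∂pairCount x ∂lam ≠ ∞ := by
    rw [← hne]
    exact hint.neg.lintegral_lt_top.ne
  have key : ∀ x : AreaOne c, transform₂ h x =
      (∫⁻ p, ENNReal.ofReal (h p) ∂pairCount x).toReal -
        (∫⁻ p, ENNReal.ofReal (-h p) ∂pairCount x).toReal := by
    intro x
    have s1 : Summable fun v : Stratum.holonomy x.1 × Stratum.holonomy x.1 =>
        max (h (v.1, v.2)) 0 := summable_of_hasFiniteSupport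
      (finite_support_holonomy_pair (f := fun p => max (h p) 0) (R := R) fun p hp =>
        hR p fun h0 => hp (by simp [h0]))
    have s2 : Summable fun v : Stratum.holonomy x.1 × Stratum.holonomy x.1 =>
        max (-h (v.1, v.2)) 0 := summable_of_hasFiniteSupport
      (finite_support_holonomy_pair (f := fun p => max (-h p) 0) (R := R) fun p hp =>
        hR p fun h0 => hp (by simp [h0]))
    have hmax : ∀ r : ℝ, r = max r 0 - max (-r) 0 := fun r => by
      rcases le_total r 0 with h | h
      · rw [max_eq_right h, max_eq_left (by linarith)]
        ring
      · rw [max_eq_left h, max_eq_right (by linarith)]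
        ring
    rw [lintegral_pairCount x hp, lintegral_pairCount x hn,
      ENNReal.tsum_toReal_eq fun _ => ENNReal.ofReal_ne_top,
      ENNReal.tsum_toReal_eq fun _ => ENNReal.ofReal_ne_top, transform₂]
    simp only [ENNReal.toReal_ofReal']
    rw [← s1.tsum_sub s2]
    exact tsum_congr fun v => hmax _
  have i1 := integrable_toReal_of_lintegral_ne_top hpm hpt
  have i2 := integrable_toReal_of_lintegral_ne_top hnm hnt
  simp only [key]
  refine ⟨i1.sub i2, ?_⟩
  rw [integral_sub i1 i2, integral_toReal hpm (ae_lt_top' hpm hpt),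
    integral_toReal hnm (ae_lt_top' hnm hnt), integral_eq_lintegral_pos_part_sub_lintegral_neg_part
    hint, hpe, hne]

end PairMeasure

/-! ## Integrals over the orbits -/

/-- For `t ≠ 0` the orbit map is proper: a bound on `(t x, y)` bounds every matrix entry. Haar
measure is thus finite on the support of `h` along the orbit. -/
theorem isCompact_norm_pairOfCoord_le (t : {t : ℝ // t ≠ 0}) (R : ℝ) :
    IsCompact {g : SL2R | ‖pairOfCoord (t, g)‖ ≤ R} := by
  have hclosed : IsClosed {g : SL2R | ‖pairOfCoord (t, g)‖ ≤ R} :=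
    isClosed_le (f := fun g : SL2R => ‖((t.1 : ℂ) * col₁ g, col₂ g)‖)
      ((continuous_const.mul continuous_col₁).prodMk continuous_col₂).norm continuous_const
  refine (isClosedEmbedding_entries.isCompact_preimage
    (isCompact_univ_pi fun _ : Fin 2 => isCompact_univ_pi fun _ : Fin 2 =>
      isCompact_closedBall (0 : ℝ) (max (R / |t.1|) R))).of_isClosed_subset hclosed ?_
  intro g hg
  have h1 : ‖col₁ g‖ ≤ R / |t.1| := by
    rw [le_div_iff₀ (abs_pos.2 t.2), mul_comm, ← Real.norm_eq_abs, ← Complex.norm_real, ← norm_mul]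
    exact (norm_fst_le (pairOfCoord (t, g))).trans hg
  have h2 : ‖col₂ g‖ ≤ R := (norm_snd_le (pairOfCoord (t, g))).trans hg
  intro i _ j _
  rw [mem_closedBall_zero_iff, Real.norm_eq_abs]
  fin_cases j
  · refine le_trans ?_ (h1.trans (le_max_left _ _))
    fin_cases i
    · exact Complex.abs_re_le_norm (col₁ g)
    · exact Complex.abs_im_le_norm (col₁ g)
  · refine le_trans ?_ (h2.trans (le_max_right _ _))
    fin_cases i
    · exact Complex.abs_re_le_norm (col₂ g)
    · exact Complex.abs_im_le_norm (col₂ g)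

theorem integrable_orbit (κ : Measure SL2R) [κ.IsHaarMeasure] {h : ℂ × ℂ → ℝ} (hh : IsBc h)
    (t : {t : ℝ // t ≠ 0}) :
    Integrable (fun g : SL2R => h ((t.1 : ℂ) * col₁ g, col₂ g)) κ := by
  obtain ⟨R, hR⟩ := exists_norm_le_of_isBc hh
  obtain ⟨C, hC⟩ := hh.bounded
  have hK := isCompact_norm_pairOfCoord_le t R
  have hs : Function.support (fun g : SL2R => h ((t.1 : ℂ) * col₁ g, col₂ g)) ⊆
      {g : SL2R | ‖pairOfCoord (t, g)‖ ≤ R} := fun g hg => hR _ hg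
  refine (integrableOn_iff_integrable_of_support_subset hs).1 ?_
  exact Measure.integrableOn_of_bounded hK.measure_lt_top.ne
    ((hh.measurable.comp (measurable_pairOfCoord.comp measurable_prodMk_left)).aestronglyMeasurable)
    (ae_of_all _ fun g => hC _)

theorem integrable_linePoint {h : ℂ × ℂ → ℝ} (hh : IsBc h) (s : OnePoint ℝ) :
    Integrable (fun x : ℂ => h (linePoint s x)) volume := by
  obtain ⟨R, hR⟩ := exists_norm_le_of_isBc hh
  obtain ⟨C, hC⟩ := hh.bounded
  have hm : Measurable (linePoint s) ∧ ∀ x, ‖x‖ ≤ ‖linePoint s x‖ := by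
    induction s using OnePoint.rec with
    | infty => exact ⟨measurable_const.prodMk measurable_id, fun x => norm_snd_le (0, x)⟩
    | coe a => exact ⟨measurable_id.prodMk (measurable_id.const_mul _),
        fun x => norm_fst_le (x, (a : ℂ) * x)⟩
  have hs : Function.support (fun x : ℂ => h (linePoint s x)) ⊆ Metric.closedBall 0 R :=
    fun x hx => mem_closedBall_zero_iff.2 ((hm.2 x).trans (hR _ hx))
  refine (integrableOn_iff_integrable_of_support_subset hs).1 ?_
  exact Measure.integrableOn_of_bounded measure_closedBall_lt_top.ne
    (hh.measurable.comp hm.1).aestronglyMeasurable (ae_of_all _ fun x => hC _)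

end SiegelVeech

end

theorem theorem2 (k : Multiset ℕ) (c : Stratum k)
    (lam : Measure (AreaOne c))
    (hinv : ∀ g : SL2R, MeasurePreserving (fun x : AreaOne c => g • x) lam lam)
    (hL2 : ∀ f : ℂ → ℝ, IsBc f → MemLp (fun x : AreaOne c => transform f x) 2 lam)
    (haar : Measure SL2R) [haar.IsHaarMeasure] :
    ∃ (ν : Measure {t : ℝ // t ≠ 0}) (η : Measure (OnePoint ℝ)),
      ∀ h : ℂ × ℂ → ℝ, IsBc h →
        Integrable (fun x : AreaOne c => transform₂ h x) lam ∧
        (∀ t : {t : ℝ // t ≠ 0},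
          Integrable (fun g : SL2R => h ((t.1 : ℂ) * col₁ g, col₂ g)) haar) ∧
        Integrable (fun t : {t : ℝ // t ≠ 0} =>
          ∫ g : SL2R, h ((t.1 : ℂ) * col₁ g, col₂ g) ∂haar) ν ∧
        (∀ s : OnePoint ℝ, Integrable (fun x : ℂ => h (linePoint s x)) volume) ∧
        Integrable (fun s : OnePoint ℝ => ∫ x : ℂ, h (linePoint s x)) η ∧
        ∫ x : AreaOne c, transform₂ h x ∂lam =
          (∫ t : {t : ℝ // t ≠ 0}, (∫ g : SL2R, h ((t.1 : ℂ) * col₁ g, col₂ g) ∂haar) ∂ν) +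
          ∫ s : OnePoint ℝ, (∫ x : ℂ, h (linePoint s x)) ∂η := by
  obtain ⟨ν, η, hν, hη, hM⟩ := exists_orbit_decomposition haar (pairMeasure lam hL2)
    (pairMeasure_closedBall_lt_top hL2) (pairMeasure_zero_prod hL2) (map_pairMeasure hL2 hinv)
  have hemb : MeasurableEmbedding ((↑) : ℝ → OnePoint ℝ) :=
    OnePoint.isOpenEmbedding_coe.measurableEmbedding
  have hΨ : Measurable fun q : ℝ × ℂ => (q.2, (q.1 : ℂ) * q.2) := by fun_prop
  -- The measure on slopes is pushed forward from `ℝ` to `ℙ¹(ℝ)`, hence has no mass at `∞`.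
  refine ⟨ν, η.map (↑), fun h hh => ?_⟩
  obtain ⟨h1, h2⟩ := integral_transform₂ hL2 hh
  have hint := integrable_of_isBc (pairMeasure_closedBall_lt_top hL2) hh
  -- Integrability for `M` gives integrability for both product measures, from which Fubini yields
  -- the absolute convergence of the outer integrals and, below, the formula.
  rw [hM, integrable_add_measure] at hint
  have e1 := hint.1.comp_measurable measurable_pairOfCoord
  have e2 := hint.2.comp_measurable hΨ
  refine ⟨h1, integrable_orbit haar hh, e1.integral_prod_left, integrable_linePoint hh, ?_, ?_⟩
  · rw [hemb.integrable_map_iff]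
    exact e2.integral_prod_left
  · rw [h2, hM, integral_add_measure hint.1 hint.2, hemb.integral_map]
    rw [integral_map measurable_pairOfCoord.aemeasurable hint.1.1,
      integral_map hΨ.aemeasurable hint.2.1]
    exact congrArg₂ (· + ·) (integral_prod _ e1) (integral_prod _ e2)
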